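/- **Definitions.** A composition of $[n]=\{1,\dots,n\}$ is an ordered sequence of disjoint non-empty sets with union $[n]$; $\mathcal C_n$ is the set of these, and $\mathcal C$ (compositions of $\mathbb N$) is the projective limit of the $\mathcal C_n$ under restriction, with its Borel $\sigma$-algebra. $\gamma_{[n]}$ is the restriction of $\gamma$ to $[n]$, and $\mathbf 1_n,\mathbf 1_{\mathbb N}$ are the one-block compositions. A measure on $\mathcal C_n$ or $\mathcal C$ is exchangeable if it is invariant under finite permutations of the labels. For $\gamma\in\mathcal C_n$ and $\gamma^{(1)},\dots,\gamma^{(n)}\in\mathcal C_n$, $\mathrm{FRAG}(\gamma,\gamma^{(\cdot)})$ is obtained by replacing each block $B$ of $\gamma$, in place, by the restriction of $\gamma^{(\min B)}$ to $B$. A $c$-fragmentation is a process $(\Gamma(t),t\ge0)$ on $\mathcal C$ such that, for every $n$, $\Gamma_{[n]}$ is a Markov process on $\mathcal C_n$, continuous in probability, with $\Gamma_{[n]}(0)=\mathbf 1_n$ a.s., for which there are exchangeable probability measures $P_{t,t'}$ $(0\le t<t')$ on $\mathcal C_n$ such that the conditional law of $\Gamma_{[n]}(t')$ given $\Gamma_{[n]}(t)=\gamma$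 is that of $\mathrm{FRAG}(\gamma,\gamma^{(\cdot)})$ with $\gamma^{(i)}$ i.i.d. of law $P_{t,t'}$. We assume moreover that each $\Gamma_{[n]}$ has a.s. right-continuous paths and, with $\tau_n$ the time of its first jump: (i) for $n\ge2$, $\tau_n<\infty$ a.s. and the law of $\tau_n$ has a density with respect to Lebesgue measure that is continuous and strictly positive on $(0,\infty)$; (ii) for every $n$ and $\gamma\in\mathcal C_n\setminus\{\mathbf 1_n\}$, $t\mapsto\mathbb P(\Gamma_{[n]}(\tau_n)=\gamma\mid\tau_n=t)$ has a version continuous on $(0,\infty)$. The family of measures $(\mu_t,t\ge0)$ of $\Gamma$ consists of exchangeable measures on $\mathcal C$ with $\mu_t(\{\mathbf 1_{\mathbb N}\})=0$ and, for all $n$ and $\gamma\in\mathcal C_n\setminus\{\mathbf 1_n\}$, $$\mu_t(\{\gamma':\gamma'_{[n]}=\gamma\})=\lim_{s\downarrow0}\tfrac1s\,\mathbb P\big(\Gamma_{[n]}(\tau_n)=\gamma,\ \tau_n\in[t,t+s]\ \big|\ \tau_n\ge t\big)<\infty .$$ Let $\mathcal U$ be the set of open subsets of $]0,1[$, with $d(U,V)=\|\chi_U-\chi_V\|_\infty$,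 $\chi_U(x)=\mathrm{dist}(x,[0,1]\setminus U)$ for $x\in[0,1]$, and its Borel $\sigma$-algebra; $s_1=s_1(U)$ is the length of the largest interval component of $U$ ($0$ if $U=\emptyset$), and $\mathbf 1=\,]0,1[$. A dislocation measure is a measure $\nu$ on $\mathcal U$ with $\nu(\{\mathbf 1\})=0$ and $\int(1-s_1)\,\nu(dU)<\infty$. For $U\in\mathcal U$, $P^U$ is the law of the composition of $\mathbb N$ built from i.i.d. uniform points $X_i$ on $[0,1]$: distinct $i,j$ are in the same block if $X_i,X_j$ lie in the same component of $U$, and otherwise the block of $i$ precedes that of $j$ iff $X_i<X_j$; and $P^\nu=\int P^U\,\nu(dU)$. For $\gamma\in\mathcal C$, let $N_0=0$ and let $N_1<\dots<N_k=n$ be the cumulative sums of the successive block sizes of $\gamma_{[n]}$; the asymptotic open set $U_\gamma$ is the limit in $(\mathcal U,d)$, if it exists, of $\bigcup_{i=1}^k\,]N_{i-1}/n,\,N_i/n[$ as $n\to\infty$. Finally $\epsilon=\sum_i\delta_{(\{i\},\,\mathbb N\setminus\{i\})}$ and $\epsilon'=\sum_i\delta_{(\mathbb N\setminus\{i\},\,\{i\})}$.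 **Corollary 4.5.** Let $(\mu_t,t\ge0)$ be the family of measures of a $c$-fragmentation as above. Then there are dislocation measures $(\nu_t,t\ge0)$ and families of nonnegative real numbers $(c_{l,t},t\ge0)$, $(c_{r,t},t\ge0)$ such that for every $t\ge0$ the set $U_\gamma$ exists for $\mu_t$-almost every $\gamma$, and $$\mu_t\mathbf 1_{\{U_\gamma\ne\mathbf 1\}}=P^{\nu_t},\qquad \mu_t\mathbf 1_{\{U_\gamma=\mathbf 1\}}=c_{l,t}\,\epsilon+c_{r,t}\,\epsilon'.$$ Moreover $t\mapsto\int_{\mathcal U}(1-s_1)\,\nu_t(dU)$, $t\mapsto c_{l,t}$ and $t\mapsto c_{r,t}$ are measurable, and for all $T\ge0$ $$\int_0^T\!\int_{\mathcal U}(1-s_1)\,\nu_t(dU)\,dt<\infty\qquad\text{and}\qquad\int_0^T(c_{l,t}+c_{r,t})\,dt<\infty .$$ -/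

import Mathlib

open MeasureTheory Set Filter
open scoped Topology NNReal ENNReal

noncomputable section

/-! ### Compositions -/

/-- A composition of the label set `ι`, i.e. a partition of `ι` into non-empty blocks together with
a total order on the blocks. It is encoded by the total preorder "the block of `i` is before, or
equal to, the block of `j`": the blocks are the equivalence classes of this preorder. For
`ι = Fin n` these are the finite ordered sequences `(A₁, …, A_k)` of disjoint non-empty sets with
union `{1, …, n}`; for `ι = ℕ` they are the points of the projective limit of these finite sets
along the restriction maps. (Labels start at `0`.) -/
@[ext] structure BlockComposition (ι : Type*) where
  /-- The block of `i` is before, or equal to, the block of `j`. -/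
  le : ι → ι → Prop
  total : ∀ i j, le i j ∨ le j i
  trans : ∀ i j k, le i j → le j k → le i k

namespace BlockComposition

variable {ι κ : Type*}

/-- `i ∼ j`: the labels `i` and `j` are in the same block. -/
def Sim (γ : BlockComposition ι) (i j : ι) : Prop := γ.le i j ∧ γ.le j i

/-- `i ≺ j`: the block of `i` is strictly before the block of `j`. -/
def Lt (γ : BlockComposition ι) (i j : ι) : Prop := ¬ γ.le j i

/-- The composition with a single block. -/
def one : BlockComposition ι := ⟨fun _ _ => True, fun _ _ => Or.inl trivial, fun _ _ _ _ _ => trivial⟩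

/-- The composition of `κ` induced by a map `f : κ → ι`. -/
def comap (f : κ → ι) (γ : BlockComposition ι) : BlockComposition κ :=
  ⟨fun i j => γ.le (f i) (f j), fun _ _ => γ.total _ _, fun _ _ _ => γ.trans _ _ _⟩

/-- The restriction `γ_[n]` of a composition of `ℕ` to the first `n` labels. -/
def restr (n : ℕ) (γ : BlockComposition ℕ) : BlockComposition (Fin n) :=
  γ.comap (fun i : Fin n => (i : ℕ))

/-- The image `σ(γ)` of a composition: its blocks are the images under `σ` of the blocks of `γ`,
in the same order. -/
def permute (σ : Equiv.Perm ι) (γ : BlockComposition ι) : BlockComposition ι := γ.comap σ.symm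

/-- The set `{γ' : γ'_[n] = γ}` of compositions of `ℕ`. -/
def cyl {n : ℕ} (γ : BlockComposition (Fin n)) : Set (BlockComposition ℕ) :=
  {γ' | γ'.restr n = γ}

/-- The `σ`-algebra generated by the events "`i` is before, or in the same block as, `j`". For
`ι = Fin n` this is the discrete one; for `ι = ℕ` it is the Borel `σ`-algebra of the projective
limit, generated by the sets `cyl γ`. -/
instance : MeasurableSpace (BlockComposition ι) :=
  MeasurableSpace.generateFrom {A | ∃ i j : ι, A = {γ | γ.le i j}}

/-- A measure on compositions is exchangeable if it is invariant under all permutations of finitely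
many labels. -/
def Exchangeable (μ : Measure (BlockComposition ι)) : Prop :=
  ∀ σ : Equiv.Perm ι, {i | σ i ≠ i}.Finite → MeasurePreserving (permute σ) μ μ

open Classical in
/-- The smallest label in the block of `i`. -/
def minLabel {n : ℕ} (γ : BlockComposition (Fin n)) (i : Fin n) : Fin n :=
  (Finset.univ.filter (fun j => γ.Sim i j)).min'
    ⟨i, Finset.mem_filter.2 ⟨Finset.mem_univ _, by simpa [Sim] using γ.total i i⟩⟩

lemma minLabel_congr {n : ℕ} (γ : BlockComposition (Fin n)) {i j : Fin n} (h : γ.Sim i j) :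
    γ.minLabel i = γ.minLabel j := by
  have : ∀ k, γ.Sim i k ↔ γ.Sim j k := fun k =>
    ⟨fun hk => ⟨γ.trans _ _ _ h.2 hk.1, γ.trans _ _ _ hk.2 h.1⟩,
     fun hk => ⟨γ.trans _ _ _ h.1 hk.1, γ.trans _ _ _ hk.2 h.2⟩⟩
  unfold minLabel
  congr 1
  ext k
  simp [this]

/-- The fragmentation operator `FRAG(γ, δ)`: each block `B` of `γ` is replaced, at its place, by
the restriction to `B` of the composition `δ m`, where `m` is the smallest label of `B`. -/
def frag {n : ℕ} (γ : BlockComposition (Fin n)) (δ : Fin n → BlockComposition (Fin n)) :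
    BlockComposition (Fin n) where
  le i j := γ.Lt i j ∨ (γ.Sim i j ∧ (δ (γ.minLabel i)).le i j)
  total i j := by
    by_cases h1 : γ.le i j
    · by_cases h2 : γ.le j i
      · rcases (δ (γ.minLabel i)).total i j with h | h
        · exact Or.inl (Or.inr ⟨⟨h1, h2⟩, h⟩)
        · exact Or.inr (Or.inr ⟨⟨h2, h1⟩, γ.minLabel_congr ⟨h1, h2⟩ ▸ h⟩)
      · exact Or.inl (Or.inl h2)
    · exact Or.inr (Or.inl h1)
  trans i j k := by
    rintro (h | ⟨h, h'⟩) (g | ⟨g, g'⟩)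
    · exact Or.inl fun hki => h (γ.trans _ _ _ ((γ.total j k).resolve_right g) hki)
    · exact Or.inl fun hki => h (γ.trans _ _ _ g.1 hki)
    · exact Or.inl fun hki => g (γ.trans _ _ _ hki h.1)
    · exact Or.inr ⟨⟨γ.trans _ _ _ h.1 g.1, γ.trans _ _ _ g.2 h.2⟩,
        (δ (γ.minLabel i)).trans _ _ _ h' (γ.minLabel_congr h ▸ g')⟩

end BlockComposition

open BlockComposition

/-! ### Fragmentation processes of compositions -/

section Fragmentation

variable {Ω : Type*} [MeasurableSpace Ω]

/-- An exchangeable fragmentation process of compositions of `{1, …, n}`: a Markov process,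
continuous in probability, started from the one-block composition, such that, for some family
`(Q t t')`, `t < t'`, of exchangeable probability measures, the conditional law of `X t'` given the
past up to time `t` is the law of `FRAG(X t, δ)`, where the `δ i` are i.i.d. with law `Q t t'`. -/
structure IsFiniteFragmentation (P : Measure Ω) (n : ℕ)
    (X : ℝ≥0 → Ω → BlockComposition (Fin n)) : Prop where
  measurable : ∀ t, Measurable (X t)
  init : ∀ᵐ ω ∂P, X 0 ω = one
  continuous_in_probability :
    ∀ t, Tendsto (fun s => P {ω | X s ω ≠ X t ω}) (𝓝 t) (𝓝 0)
  semigroup : ∃ Q : ℝ≥0 → ℝ≥0 → Measure (BlockComposition (Fin n)),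
    ∀ t t', t < t' → IsProbabilityMeasure (Q t t') ∧ Exchangeable (Q t t') ∧
      ∀ (A : Set Ω), MeasurableSet[⨆ s : Set.Iic t, MeasurableSpace.comap (X s) inferInstance] A →
        ∀ γ γ' : BlockComposition (Fin n),
          P (A ∩ {ω | X t ω = γ} ∩ {ω | X t' ω = γ'}) =
            P (A ∩ {ω | X t ω = γ}) *
              (Measure.pi fun _ : Fin n => Q t t') {δ | frag γ δ = γ'}

/-- A `c`-fragmentation (not necessarily homogeneous in time): a process of compositions of `ℕ`
all of whose restrictions to finitely many labels are exchangeable fragmentation processes. (The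
Markov property of the process itself follows from that of its restrictions.) -/
def IsCFragmentation (P : Measure Ω) (Γ : ℝ≥0 → Ω → BlockComposition ℕ) : Prop :=
  ∀ n, IsFiniteFragmentation P n (fun t ω => (Γ t ω).restr n)

/-- The time `τ_n` of the first jump of `Γ_[n]` (infinite if there is none). -/
def firstJump (Γ : ℝ≥0 → Ω → BlockComposition ℕ) (n : ℕ) (ω : Ω) : ℝ≥0∞ :=
  ⨅ (t : ℝ≥0) (_ : (Γ t ω).restr n ≠ one), (t : ℝ≥0∞)

/-- The state `Γ_[n](τ_n)` entered by the first jump of `Γ_[n]`. -/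
def firstState (Γ : ℝ≥0 → Ω → BlockComposition ℕ) (n : ℕ) (ω : Ω) : BlockComposition (Fin n) :=
  (Γ (firstJump Γ n ω).toNNReal ω).restr n

/-- The law `λ_n` of the first jump time of `Γ_[n]`. -/
def firstJumpLaw (P : Measure Ω) (Γ : ℝ≥0 → Ω → BlockComposition ℕ) (n : ℕ) : Measure ℝ :=
  P.map fun ω => (firstJump Γ n ω).toReal

/-- The class of time-inhomogeneous `c`-fragmentations under consideration. -/
structure IsRegularCFragmentation (P : Measure Ω) (Γ : ℝ≥0 → Ω → BlockComposition ℕ) :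
    Prop where
  isCFragmentation : IsCFragmentation P Γ
  /-- The jump processes `Γ_[n]` have right-continuous paths (in a finite discrete space). -/
  right_continuous : ∀ n, ∀ᵐ ω ∂P, ∀ t, ∀ᶠ s in 𝓝[>] t, (Γ s ω).restr n = (Γ t ω).restr n
  /-- The law of the first jump time has a continuous and strictly positive density. For fewer than
  two labels there is only one composition, hence no jump. -/
  density : ∀ n, 2 ≤ n → (∀ᵐ ω ∂P, firstJump Γ n ω ≠ ∞) ∧
    ∃ f : ℝ → ℝ≥0, ContinuousOn f (Ioi 0) ∧ (∀ t, 0 < t → 0 < f t) ∧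
      firstJumpLaw P Γ n = (volume.restrict (Ioi 0)).withDensity (fun t => (f t : ℝ≥0∞))
  /-- The conditional probability that `Γ_[n](τ_n) = γ` given `τ_n = t` is continuous in `t`. -/
  continuous_state : ∀ n, ∀ γ : BlockComposition (Fin n), γ ≠ one →
    ∃ h : ℝ → ℝ≥0, ContinuousOn h (Ioi 0) ∧ ∀ B : Set ℝ, MeasurableSet B →
      P {ω | firstState Γ n ω = γ ∧ (firstJump Γ n ω).toReal ∈ B} =
        ∫⁻ t in B, (h t : ℝ≥0∞) ∂(firstJumpLaw P Γ n)

/-- `q` is the instantaneous rate of jump at time `t` from the one-block composition to `γ`: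
`q = lim_{s ↓ 0} s⁻¹ P(Γ_[n](τ_n) = γ, τ_n ∈ [t, t + s] | τ_n ≥ t)`. -/
def HasJumpRate (P : Measure Ω) (Γ : ℝ≥0 → Ω → BlockComposition ℕ) {n : ℕ}
    (γ : BlockComposition (Fin n)) (t q : ℝ≥0) : Prop :=
  Tendsto (fun s : ℝ≥0 =>
      (ProbabilityTheory.cond P {ω | (t : ℝ≥0∞) ≤ firstJump Γ n ω})
        {ω | firstState Γ n ω = γ ∧ firstJump Γ n ω ∈ Icc (t : ℝ≥0∞) ((t + s : ℝ≥0) : ℝ≥0∞)}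
        / (s : ℝ≥0∞))
    (𝓝[>] 0) (𝓝 (q : ℝ≥0∞))

/-- `(μ_t)` is the family of measures of `Γ`: for every `t ≥ 0`, `μ_t` is exchangeable, gives no
mass to the one-block composition, and gives to `{γ' : γ'_[n] = γ}` the rate of jump to `γ` at
time `t`, for all `n` and all compositions `γ` of `{1, …, n}` with at least two blocks. -/
structure IsMeasureFamily (P : Measure Ω) (Γ : ℝ≥0 → Ω → BlockComposition ℕ)
    (μ : ℝ≥0 → Measure (BlockComposition ℕ)) : Prop where
  exchangeable : ∀ t, Exchangeable (μ t)
  one_eq_zero : ∀ t, μ t {one} = 0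
  rate : ∀ t, ∀ n, ∀ γ : BlockComposition (Fin n), γ ≠ one →
    ∃ q : ℝ≥0, HasJumpRate P Γ γ t q ∧ μ t (cyl γ) = q

end Fragmentation

/-! ### Open subsets of `]0,1[` -/

/-- The set `𝒰` of open subsets of `]0,1[`. -/
@[ext] structure OpenSub where
  carrier : Set ℝ
  isOpen : IsOpen carrier
  subset : carrier ⊆ Ioo 0 1

namespace OpenSub

/-- The element `]0,1[` of `𝒰`. -/
def one : OpenSub := ⟨Ioo 0 1, isOpen_Ioo, subset_rfl⟩

/-- The function `χ_U(x)`, the distance of `x ∈ [0,1]` to `[0,1] \ U`. -/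
def chi (U : OpenSub) : C(unitInterval, ℝ) :=
  ⟨fun x => Metric.infDist (x : ℝ) (Icc 0 1 \ U.carrier),
    (Metric.continuous_infDist_pt _).comp continuous_subtype_val⟩

lemma chi_pos_iff (U : OpenSub) (x : unitInterval) : 0 < U.chi x ↔ (x : ℝ) ∈ U.carrier := by
  have hc : IsClosed (Icc (0 : ℝ) 1 \ U.carrier) := isClosed_Icc.sdiff U.isOpen
  have hne : (Icc (0 : ℝ) 1 \ U.carrier).Nonempty :=
    ⟨0, by simp, fun h => lt_irrefl _ (U.subset h).1⟩
  have := hc.notMem_iff_infDist_pos hne (x := (x : ℝ))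
  rw [chi, ContinuousMap.coe_mk, ← this]
  simp

lemma chi_injective : Function.Injective chi := by
  intro U V h
  ext x
  constructor
  · intro hx
    have hI : x ∈ Icc (0 : ℝ) 1 := Ioo_subset_Icc_self (U.subset hx)
    exact (chi_pos_iff V ⟨x, hI⟩).1 (h ▸ (chi_pos_iff U ⟨x, hI⟩).2 hx)
  · intro hx
    have hI : x ∈ Icc (0 : ℝ) 1 := Ioo_subset_Icc_self (V.subset hx)
    exact (chi_pos_iff U ⟨x, hI⟩).1 (h ▸ (chi_pos_iff V ⟨x, hI⟩).2 hx)

/-- The distance `d(U,V) = sup_{x ∈ [0,1]} |χ_U(x) - χ_V(x)|`. -/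
instance : MetricSpace OpenSub := MetricSpace.induced chi chi_injective inferInstance

instance : MeasurableSpace OpenSub := borel OpenSub
instance : BorelSpace OpenSub := ⟨rfl⟩

/-- `x` and `y` belong to the same component interval of `U`. -/
def Same (U : OpenSub) (x y : ℝ) : Prop := x ∈ U.carrier ∧ y ∈ connectedComponentIn U.carrier x

/-- The length of the largest interval component of `U` (zero if `U` is empty). -/
def s1 (U : OpenSub) : ℝ≥0∞ := ⨆ x ∈ U.carrier, volume (connectedComponentIn U.carrier x)

lemma Same.symm {U : OpenSub} {x y : ℝ} (h : U.Same x y) : U.Same y x :=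
  ⟨connectedComponentIn_subset _ _ h.2,
    connectedComponentIn_eq h.2 ▸ mem_connectedComponentIn h.1⟩

lemma Same.trans {U : OpenSub} {x y z : ℝ} (h : U.Same x y) (h' : U.Same y z) : U.Same x z :=
  ⟨h.1, by rw [connectedComponentIn_eq h.2]; exact h'.2⟩

lemma Same.of_mem {U : OpenSub} {x y z : ℝ} (h : U.Same x z) (hy : y ∈ Icc x z) : U.Same x y :=
  ⟨h.1, isPreconnected_connectedComponentIn.ordConnected.out
    (mem_connectedComponentIn h.1) h.2 hy⟩

/-- The composition of `ℕ` obtained from `U` and points `X_i`, where distinct labels are in the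
same block if their points are in the same component interval of `U`, and otherwise are ordered as
their points. (Distinct labels with equal points outside `U`, a null event, share a block.) -/
def paint (U : OpenSub) (X : ℕ → unitInterval) : BlockComposition ℕ where
  le i j := X i ≤ X j ∨ U.Same (X i) (X j)
  total i j := (le_total (X i) (X j)).imp Or.inl Or.inl
  trans i j k := by
    rintro (h | h) (g | g)
    · exact Or.inl (h.trans g)
    · rcases le_total (X i) (X k) with hik | hik
      · exact Or.inl hik
      · exact Or.inr (g.symm.of_mem ⟨hik, h⟩).symm
    · rcases le_total (X i) (X k) with hik | hik
      · exact Or.inl hik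
      · exact Or.inr (h.trans (h.symm.of_mem ⟨g, hik⟩))
    · exact Or.inr (h.trans g)

/-- The law `P^U` of the composition obtained from `U` and i.i.d. uniform points on `[0,1]`. -/
def paintLaw (U : OpenSub) : Measure (BlockComposition ℕ) :=
  (Measure.infinitePi fun _ : ℕ => (volume : Measure unitInterval)).map U.paint

end OpenSub

/-- The measure `P^ν(dγ) = ∫ P^U(dγ) ν(dU)`. -/
def paintMeasure (ν : Measure OpenSub) : Measure (BlockComposition ℕ) := ν.bind OpenSub.paintLaw

/-- Dislocation measures: `ν({]0,1[}) = 0` and `∫ (1 - s₁) ν(dU) < ∞`. -/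
structure IsDislocationMeasure (ν : Measure OpenSub) : Prop where
  one_eq_zero : ν {OpenSub.one} = 0
  lintegral_lt_top : ∫⁻ U, (1 - U.s1) ∂ν < ∞

/-! ### Asymptotic open sets and erosion -/

namespace BlockComposition

/-- The open set of a composition `(A₁, …, A_k)` of `{1, …, n}`: the union of the intervals
`](n₁ + ⋯ + n_{i-1})/n, (n₁ + ⋯ + n_i)/n[`, where `n_i` is the size of `A_i`. -/
def toOpenSub {n : ℕ} (γ : BlockComposition (Fin n)) : OpenSub where
  carrier := ⋃ j : Fin n,
    Ioo (({i | γ.Lt i j}.ncard : ℝ) / n) (({i | γ.le i j}.ncard : ℝ) / n)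
  isOpen := isOpen_iUnion fun _ => isOpen_Ioo
  subset := by
    refine iUnion_subset fun j => Ioo_subset_Ioo (by positivity) ?_
    refine div_le_one_of_le₀ ?_ (by positivity)
    exact_mod_cast (Set.ncard_le_card _).trans_eq (Nat.card_fin n)

/-- `U` is the asymptotic open set `U_γ` of `γ`, i.e. the limit of the open sets of `γ_[n]`. -/
def HasAsympOpen (γ : BlockComposition ℕ) (U : OpenSub) : Prop :=
  Tendsto (fun n => (γ.restr n).toOpenSub) atTop (𝓝 U)

/-- The composition `ε_i = ({i}, ℕ \ {i})`. -/
def epsLeft (i : ℕ) : BlockComposition ℕ where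
  le a b := a = i ∨ b ≠ i
  total a b := by by_cases a = i <;> simp_all
  trans a b c := by rintro (h | h) (g | g) <;> simp_all

/-- The composition `ε'_i = (ℕ \ {i}, {i})`. -/
def epsRight (i : ℕ) : BlockComposition ℕ where
  le a b := a ≠ i ∨ b = i
  total a b := by by_cases a = i <;> simp_all
  trans a b c := by rintro (h | h) (g | g) <;> simp_all

end BlockComposition

/-- The left erosion measure `ε = ∑ᵢ δ_{ε_i}`. -/
def erosionLeft : Measure (BlockComposition ℕ) := Measure.sum fun i => Measure.dirac (epsLeft i)

/-- The right erosion measure `ε' = ∑ᵢ δ_{ε'_i}`. -/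
def erosionRight : Measure (BlockComposition ℕ) := Measure.sum fun i => Measure.dirac (epsRight i)

end

/-! ### The metric space of open subsets of `]0,1[` -/

/-! Fix `t` and write `μ` for `μ t`. There are finitely many compositions of `{1, …, n}` and each
nontrivial one has a finite rate, so `μ` is finite on every `nontriv n`; these sets exhaust
everything but the null point `one`. For a finite exchangeable measure `m`, painting with the open
set of `γ_[N+1]` amounts to sampling labels of `γ_[N+1]` uniformly with replacement
(`paintLaw_toOpenSub`). As `N → ∞` the sampled labels become distinct, so exchangeability makes the
mixture of painted laws converge to `m` on cylinders. Compactness of `𝒰` and continuity of `U ↦ P^U`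
on cylinders then give `m = P^η` (`exists_eq_paintMeasure`). Since `U` is recovered from a
`P^U`-typical composition by Glivenko–Cantelli, `m` disintegrates over its asymptotic open set. For
infinite `μ`, restrict to `nontriv n` and drop the first `n` labels: the result is finite and
exchangeable, with the same asymptotic open sets. Where `U_γ ≠ ]0,1[`, exchanging the first `k`
labels with the next `n` and letting `n → ∞` gives the law of `γ_[k]`, and `ν` is the image of `μ`
under `asymp` (`restrict_asymp_ne_one`). Where `U_γ = ]0,1[`, almost every `γ` has a cofinite block
with complement `S`. If `S` had two elements, infinitely many disjoint events of equal mass would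
fit into a set of finite mass, so `S` is a singleton and only erosion remains
(`restrict_asymp_eq_one`). In time, rates are limits of quotients `ρ [t, t+s] / s` times an inverse
survival probability, where `ρ` is a subprobability. Limits preserve measurability, and Fatou with
Fubini bounds the integral over `[0,T]` by `1 / P(τ_n ≥ T)`. The integrals claimed finite are
dominated by that of `μ t (nontriv 2)`, because `1 - s₁` is at most the `P^U`-probability that two
labels are separated. -/

namespace OpenSub

/-- The complement of `U` in `[0,1]`. -/
def gap (U : OpenSub) : Set ℝ := Icc 0 1 \ U.carrier

lemma isClosed_gap (U : OpenSub) : IsClosed U.gap := isClosed_Icc.sdiff U.isOpen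

lemma zero_mem_gap (U : OpenSub) : (0 : ℝ) ∈ U.gap := ⟨by simp, fun h => lt_irrefl _ (U.subset h).1⟩

lemma one_mem_gap (U : OpenSub) : (1 : ℝ) ∈ U.gap := ⟨by simp, fun h => lt_irrefl _ (U.subset h).2⟩

lemma isCompact_gap (U : OpenSub) : IsCompact U.gap :=
  isCompact_Icc.of_isClosed_subset U.isClosed_gap sdiff_subset

lemma mem_carrier_of_notMem_gap {U : OpenSub} {x : ℝ} (hx : x ∈ Icc (0 : ℝ) 1) (h : x ∉ U.gap) :
    x ∈ U.carrier := by
  by_contra h'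
  exact h ⟨hx, h'⟩

lemma chi_apply (U : OpenSub) (x : unitInterval) : U.chi x = Metric.infDist (x : ℝ) U.gap := rfl

lemma chi_le_of_gap {U V : OpenSub} {r : ℝ} (h : ∀ c ∈ V.gap, ∃ c' ∈ U.gap, |c - c'| ≤ r)
    (x : unitInterval) : U.chi x ≤ V.chi x + r := by
  obtain ⟨c, hc, hcx⟩ := V.isCompact_gap.exists_infDist_eq_dist ⟨0, V.zero_mem_gap⟩ (x : ℝ)
  obtain ⟨c', hc', h'⟩ := h c hc
  rw [chi_apply, chi_apply, hcx]
  calc Metric.infDist (x : ℝ) U.gap ≤ dist (x : ℝ) c' := Metric.infDist_le_dist_of_mem hc'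
    _ ≤ dist (x : ℝ) c + dist c c' := dist_triangle _ _ _
    _ ≤ _ := by rw [Real.dist_eq c c']; gcongr

/-- `chi` is the distance function to the gap, so Hausdorff closeness of gaps bounds `d`. Later
estimates of `d` by counting all go through this. -/
lemma dist_le_of_gap {U V : OpenSub} {r : ℝ} (hr : 0 ≤ r)
    (h₁ : ∀ c ∈ U.gap, ∃ c' ∈ V.gap, |c - c'| ≤ r)
    (h₂ : ∀ c ∈ V.gap, ∃ c' ∈ U.gap, |c - c'| ≤ r) : dist U V ≤ r := by
  change dist U.chi V.chi ≤ r
  refine (ContinuousMap.dist_le hr).2 fun x => ?_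
  rw [Real.dist_eq, abs_sub_le_iff]
  have := chi_le_of_gap h₁ x
  have := chi_le_of_gap h₂ x
  constructor <;> linarith

lemma abs_chi_sub_le (U V : OpenSub) (x : unitInterval) : |U.chi x - V.chi x| ≤ dist U V := by
  rw [← Real.dist_eq]
  exact ContinuousMap.dist_apply_le_dist x

/-- The open set whose complement in `[0,1]` is `K ∪ {0, 1}`. -/
def ofCompacts (K : TopologicalSpace.NonemptyCompacts unitInterval) : OpenSub where
  carrier := Ioo 0 1 \ Subtype.val '' (K : Set unitInterval)
  isOpen := isOpen_Ioo.sdiff (K.isCompact.image continuous_subtype_val).isClosed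
  subset := sdiff_subset

lemma mem_gap_ofCompacts {K : TopologicalSpace.NonemptyCompacts unitInterval} {x : ℝ} :
    x ∈ (ofCompacts K).gap ↔ x = 0 ∨ x = 1 ∨ ∃ y ∈ K, (y : ℝ) = x := by
  constructor
  · rintro ⟨hx, h⟩
    by_cases h0 : x = 0
    · exact Or.inl h0
    by_cases h1 : x = 1
    · exact Or.inr (Or.inl h1)
    right; right
    by_contra h'
    refine h ⟨⟨lt_of_le_of_ne hx.1 (Ne.symm h0), lt_of_le_of_ne hx.2 h1⟩, ?_⟩
    rintro ⟨y, hy, rfl⟩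
    exact h' ⟨y, hy, rfl⟩
  · rintro (rfl | rfl | ⟨y, hy, rfl⟩)
    · exact zero_mem_gap _
    · exact one_mem_gap _
    · exact ⟨y.2, fun h => h.2 ⟨y, hy, rfl⟩⟩

lemma exists_gap_ofCompacts_near {K L : TopologicalSpace.NonemptyCompacts unitInterval} {r : ℝ}
    (h : dist K L < r) (c : ℝ) (hc : c ∈ (ofCompacts K).gap) :
    ∃ c' ∈ (ofCompacts L).gap, |c - c'| ≤ r := by
  have hr : 0 ≤ r := dist_nonneg.trans h.le
  rcases mem_gap_ofCompacts.1 hc with rfl | rfl | ⟨y, hy, rfl⟩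
  · exact ⟨0, zero_mem_gap _, by simpa⟩
  · exact ⟨1, one_mem_gap _, by simpa⟩
  · rw [Metric.NonemptyCompacts.dist_eq] at h
    obtain ⟨z, hz, hyz⟩ := Metric.exists_dist_lt_of_hausdorffDist_lt (x := y) hy h
      (Metric.hausdorffEDist_ne_top_of_nonempty_of_bounded K.nonempty L.nonempty
        K.isCompact.isBounded L.isCompact.isBounded)
    exact ⟨z, mem_gap_ofCompacts.2 (Or.inr (Or.inr ⟨z, hz, rfl⟩)), hyz.le⟩

lemma continuous_ofCompacts : Continuous ofCompacts := by
  refine Metric.continuous_iff.2 fun K ε hε => ⟨ε / 2, by positivity, fun L hL => ?_⟩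
  refine (dist_le_of_gap (by positivity) (exists_gap_ofCompacts_near hL)
    (exists_gap_ofCompacts_near ?_)).trans_lt (half_lt_self hε)
  rwa [dist_comm]

lemma surjective_ofCompacts : Function.Surjective ofCompacts := by
  intro U
  refine ⟨⟨⟨Subtype.val ⁻¹' U.gap,
    (U.isClosed_gap.preimage continuous_subtype_val).isCompact⟩, ⟨0, U.zero_mem_gap⟩⟩, ?_⟩
  ext x
  constructor
  · rintro ⟨hx, h⟩
    by_contra h'
    exact h ⟨⟨x, Ioo_subset_Icc_self hx⟩, ⟨Ioo_subset_Icc_self hx, h'⟩, rfl⟩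
  · intro hx
    refine ⟨U.subset hx, ?_⟩
    rintro ⟨y, hy, rfl⟩
    exact hy.2 hx

/-- `𝒰` is a continuous image of the compact hyperspace of nonempty closed subsets of `[0,1]`. This
supplies limit points of measures of bounded mass on `𝒰`. -/
instance : CompactSpace OpenSub :=
  ⟨by rw [← surjective_ofCompacts.range_eq]; exact isCompact_range continuous_ofCompacts⟩

/-! ### Borel measurability of the largest component length -/

lemma chi_le_left (U : OpenSub) (x : unitInterval) : U.chi x ≤ x := by
  refine (Metric.infDist_le_dist_of_mem U.zero_mem_gap).trans ?_
  simp [abs_of_nonneg x.2.1]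

lemma chi_le_right (U : OpenSub) (x : unitInterval) : U.chi x ≤ 1 - x := by
  refine (Metric.infDist_le_dist_of_mem U.one_mem_gap).trans ?_
  rw [Real.dist_eq, abs_of_nonpos] <;> linarith [x.2.2]

lemma ball_chi_subset (U : OpenSub) (x : unitInterval) :
    Metric.ball (x : ℝ) (U.chi x) ⊆ U.carrier := by
  intro y hy
  have hy' := hy
  rw [Metric.mem_ball, Real.dist_eq, abs_lt] at hy'
  refine mem_carrier_of_notMem_gap ⟨by linarith [U.chi_le_left x], by linarith [U.chi_le_right x]⟩ ?_
  intro h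
  rw [Metric.mem_ball, chi_apply, dist_comm] at hy
  refine absurd hy (not_lt.2 ?_)
  exact Metric.infDist_le_dist_of_mem h

/-- The midpoint of a component is at least half its length away from the gap, and conversely the
ball of radius `chi x` about `x` lies in one component. As a supremum of continuous functions, `s1`
is lower semicontinuous. -/
lemma s1_eq_iSup_chi (U : OpenSub) : U.s1 = ⨆ x : unitInterval, ENNReal.ofReal (2 * U.chi x) := by
  apply le_antisymm
  · refine iSup₂_le fun x hx => ?_
    set C := connectedComponentIn U.carrier x with hC
    have hCU : C ⊆ U.carrier := connectedComponentIn_subset _ _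
    have hC01 : C ⊆ Ioo 0 1 := hCU.trans U.subset
    have hconn : C.OrdConnected := isPreconnected_connectedComponentIn.ordConnected
    have hne : C.Nonempty := ⟨x, mem_connectedComponentIn hx⟩
    have hbb : BddBelow C := bddBelow_Ioo.mono hC01
    have hba : BddAbove C := bddAbove_Ioo.mono hC01
    have hsub : C ⊆ Icc (sInf C) (sSup C) := fun y hy => ⟨csInf_le hbb hy, le_csSup hba hy⟩
    have hsup : Ioo (sInf C) (sSup C) ⊆ C := by
      rintro y ⟨h1, h2⟩
      obtain ⟨a, ha, hay⟩ := exists_lt_of_csInf_lt hne h1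
      obtain ⟨b, hb, hyb⟩ := exists_lt_of_lt_csSup hne h2
      exact hconn.out ha hb ⟨hay.le, hyb.le⟩
    have h0 : 0 ≤ sInf C := le_csInf hne fun y hy => (hC01 hy).1.le
    have h1 : sSup C ≤ 1 := csSup_le hne fun y hy => (hC01 hy).2.le
    have hle : sInf C ≤ sSup C := csInf_le_csSup hne hbb hba
    let m : unitInterval := ⟨(sInf C + sSup C) / 2, by constructor <;> linarith⟩
    calc volume C ≤ volume (Icc (sInf C) (sSup C)) := measure_mono hsub
      _ = ENNReal.ofReal (sSup C - sInf C) := Real.volume_Icc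
      _ ≤ ENNReal.ofReal (2 * U.chi m) := by
        apply ENNReal.ofReal_le_ofReal
        rw [← div_le_iff₀' two_pos, chi_apply]
        refine (Metric.le_infDist ⟨0, U.zero_mem_gap⟩).2 fun {y} hy => ?_
        by_contra! hlt
        rw [Real.dist_eq, abs_lt] at hlt
        refine hy.2 (hCU (hsup ⟨?_, ?_⟩)) <;> simp only [m] at hlt <;> linarith
      _ ≤ _ := le_iSup (fun x : unitInterval => ENNReal.ofReal (2 * U.chi x)) m
  · refine iSup_le fun x => ?_
    by_cases hx : 0 < U.chi x
    · have hxU := (U.chi_pos_iff x).1 hx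
      refine le_trans ?_ (le_iSup₂ (f := fun x (_ : x ∈ U.carrier) =>
        volume (connectedComponentIn U.carrier x)) (x : ℝ) hxU)
      rw [← Real.volume_ball]
      exact measure_mono <| (convex_ball _ _).isPreconnected.subset_connectedComponentIn
        (Metric.mem_ball_self hx) (U.ball_chi_subset x)
    · rw [ENNReal.ofReal_of_nonpos (by linarith)]
      exact zero_le

lemma continuous_chi_apply (x : unitInterval) : Continuous fun U : OpenSub => U.chi x := by
  refine Metric.continuous_iff.2 fun U ε hε => ⟨ε, hε, fun V hV => ?_⟩
  exact (ContinuousMap.dist_apply_le_dist (f := V.chi) (g := U.chi) x).trans_lt hV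

lemma measurable_s1 : Measurable s1 := by
  have : s1 = fun U : OpenSub => ⨆ x : unitInterval, ENNReal.ofReal (2 * U.chi x) :=
    funext s1_eq_iSup_chi
  rw [this]
  refine (lowerSemicontinuous_iSup fun x => Continuous.lowerSemicontinuous ?_).measurable
  exact ENNReal.continuous_ofReal.comp (continuous_const.mul (continuous_chi_apply x))

end OpenSub

/-! ### Compositions -/

namespace BlockComposition

variable {ι κ : Type*}

protected lemma le_refl (γ : BlockComposition ι) (i : ι) : γ.le i i := (γ.total i i).elim id id

instance [Finite ι] : Finite (BlockComposition ι) :=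
  Finite.of_injective (fun γ : BlockComposition ι => γ.le) fun _ _ h => BlockComposition.ext h

lemma measurableSet_setOf_le (i j : ι) : MeasurableSet {γ : BlockComposition ι | γ.le i j} :=
  MeasurableSpace.measurableSet_generateFrom ⟨i, j, rfl⟩

lemma measurable_iff {α : Type*} [MeasurableSpace α] {f : α → BlockComposition ι} :
    Measurable f ↔ ∀ i j, MeasurableSet {x | (f x).le i j} := by
  refine ⟨fun h i j => h (measurableSet_setOf_le i j), fun h => measurable_generateFrom ?_⟩
  rintro _ ⟨i, j, rfl⟩
  exact h i j

instance [Countable ι] : MeasurableSingletonClass (BlockComposition ι) where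
  measurableSet_singleton γ := by
    have : {γ} = ⋂ i, ⋂ j, {γ' : BlockComposition ι | γ'.le i j ↔ γ.le i j} := by
      ext γ'
      simp only [mem_singleton_iff, mem_iInter, mem_ofPred_eq]
      exact ⟨fun h => by simp [h], fun h => BlockComposition.ext (by ext i j; exact h i j)⟩
    rw [this]
    refine MeasurableSet.iInter fun i => MeasurableSet.iInter fun j => ?_
    by_cases h : γ.le i j
    · simpa [h] using measurableSet_setOf_le i j
    · simp only [h, iff_false]
      exact (measurableSet_setOf_le i j).compl

lemma measurable_comap (f : κ → ι) : Measurable (comap f) :=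
  measurable_iff.2 fun i j => measurableSet_setOf_le (f i) (f j)

lemma measurable_restr (n : ℕ) : Measurable (restr n) := measurable_comap _

lemma measurable_permute (σ : Equiv.Perm ι) : Measurable (permute σ) := measurable_comap _

/-! ### Cylinder sets -/

/-- The sets of compositions of `ℕ` determined by finitely many labels. -/
def cylinders : Set (Set (BlockComposition ℕ)) :=
  {S | ∃ (n : ℕ) (B : Set (BlockComposition (Fin n))), S = restr n ⁻¹' B}

lemma measurableSet_restr_preimage {n : ℕ} (B : Set (BlockComposition (Fin n))) :
    MeasurableSet (restr n ⁻¹' B) := measurable_restr n (MeasurableSet.of_discrete)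

lemma restr_preimage_eq {n m : ℕ} (h : n ≤ m) (B : Set (BlockComposition (Fin n))) :
    restr n ⁻¹' B = restr m ⁻¹' (comap (Fin.castLE h) ⁻¹' B) := rfl

lemma isPiSystem_cylinders : IsPiSystem cylinders := by
  rintro _ ⟨n, B, rfl⟩ _ ⟨m, C, rfl⟩ -
  rw [restr_preimage_eq (le_max_left n m) B, restr_preimage_eq (le_max_right n m) C,
    ← preimage_inter]
  exact ⟨_, _, rfl⟩

lemma generateFrom_cylinders :
    (inferInstance : MeasurableSpace (BlockComposition ℕ)) =
      MeasurableSpace.generateFrom cylinders := by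
  apply le_antisymm
  · refine MeasurableSpace.generateFrom_le ?_
    rintro _ ⟨i, j, rfl⟩
    refine MeasurableSpace.measurableSet_generateFrom ⟨max i j + 1,
      {γ | γ.le ⟨i, by omega⟩ ⟨j, by omega⟩}, rfl⟩
  · refine MeasurableSpace.generateFrom_le ?_
    rintro _ ⟨n, B, rfl⟩
    exact measurableSet_restr_preimage B

/-- The compositions of `ℕ` whose restriction to the first `n` labels has at least two blocks. -/
def nontriv (n : ℕ) : Set (BlockComposition ℕ) := {γ | γ.restr n ≠ one}

lemma nontriv_eq (n : ℕ) : nontriv n = restr n ⁻¹' {one}ᶜ := rfl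

lemma measurableSet_nontriv (n : ℕ) : MeasurableSet (nontriv n) :=
  measurableSet_restr_preimage {one}ᶜ

lemma nontriv_mono : Monotone nontriv := by
  intro n m h γ hγ hm
  apply hγ
  have : γ.restr n = (γ.restr m).comap (Fin.castLE h) := rfl
  rw [this, hm]
  rfl

lemma iUnion_nontriv : ⋃ n, nontriv n = {one}ᶜ := by
  ext γ
  simp only [mem_iUnion, mem_compl_iff, mem_singleton_iff]
  constructor
  · rintro ⟨n, hn⟩ rfl
    exact hn rfl
  · intro h
    by_contra! h'
    refine h (BlockComposition.ext ?_)
    ext i j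
    have := h' (max i j + 1)
    have : γ.restr (max i j + 1) = one := by simpa [nontriv] using this
    have h2 : (γ.restr (max i j + 1)).le ⟨i, by omega⟩ ⟨j, by omega⟩ := by rw [this]; trivial
    exact ⟨fun _ => trivial, fun _ => h2⟩

/-- The sets `nontriv n` increase to the complement of `one`; this reduces the infinite measures
below to finite ones. -/
lemma measure_eq_iSup_nontriv {ρ : Measure (BlockComposition ℕ)} (h : ρ {one} = 0)
    (S : Set (BlockComposition ℕ)) : ρ S = ⨆ n, ρ (S ∩ nontriv n) := by
  rw [← Monotone.measure_iUnion fun n m h => inter_subset_inter_right _ (nontriv_mono h),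
    ← inter_iUnion, iUnion_nontriv]
  apply le_antisymm
  · calc ρ S ≤ ρ ((S ∩ {one}ᶜ) ∪ {one}) := measure_mono fun γ hγ => by
          by_cases hh : γ = one
          · exact Or.inr hh
          · exact Or.inl ⟨hγ, hh⟩
      _ ≤ ρ (S ∩ {one}ᶜ) + ρ {one} := measure_union_le _ _
      _ = _ := by rw [h, add_zero]
  · exact measure_mono inter_subset_left

lemma inter_nontriv_mem_cylinders {S : Set (BlockComposition ℕ)} (hS : S ∈ cylinders) (n : ℕ) :
    S ∩ nontriv n ∈ cylinders := by
  obtain ⟨k, B, rfl⟩ := hS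
  rw [nontriv_eq, restr_preimage_eq (le_max_left k n) B, restr_preimage_eq (le_max_right k n),
    ← preimage_inter]
  exact ⟨_, _, rfl⟩

/-- Uniqueness on a π-system needs finiteness, hence the restriction to each `nontriv n`, itself a
cylinder. -/
lemma measure_ext_cylinders {ρ ρ' : Measure (BlockComposition ℕ)} (h : ρ {one} = 0)
    (h' : ρ' {one} = 0) (hfin : ∀ n, ρ (nontriv n) < ∞) (heq : ∀ S ∈ cylinders, ρ S = ρ' S) :
    ρ = ρ' := by
  ext S hS
  rw [measure_eq_iSup_nontriv h, measure_eq_iSup_nontriv h']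
  congr 1
  ext n
  rw [← Measure.restrict_apply hS, ← Measure.restrict_apply hS]
  congr 1
  have : IsFiniteMeasure (ρ.restrict (nontriv n)) := ⟨by simpa using hfin n⟩
  refine ext_of_generate_finite cylinders generateFrom_cylinders isPiSystem_cylinders ?_ ?_
  · rintro _ ⟨k, B, rfl⟩
    rw [Measure.restrict_apply (measurableSet_restr_preimage B),
      Measure.restrict_apply (measurableSet_restr_preimage B)]
    exact heq _ (inter_nontriv_mem_cylinders ⟨k, B, rfl⟩ n)
  · rw [Measure.restrict_apply_univ, Measure.restrict_apply_univ]
    exact heq _ ⟨n, _, nontriv_eq n⟩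

/-! ### The open set of a finite composition -/

/-- A set of labels which contains all labels before any of its elements. -/
def IsDown (γ : BlockComposition ι) (D : Set ι) : Prop := ∀ i ∈ D, ∀ j, γ.le j i → j ∈ D

lemma isDown_setOf_le (γ : BlockComposition ι) (j : ι) : γ.IsDown {i | γ.le i j} :=
  fun _ hi _ hk => γ.trans _ _ _ hk hi

lemma exists_least [Finite ι] (γ : BlockComposition ι) {D : Set ι} (hD : D.Nonempty) :
    ∃ j ∈ D, ∀ i ∈ D, γ.le j i := by
  let r : Preorder ι :=
    { le := γ.le
      le_refl := γ.le_refl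
      le_trans := γ.trans }
  obtain ⟨j, hj⟩ := D.toFinite.exists_minimal hD
  exact ⟨j, hj.1, fun i hi => (γ.total j i).elim id fun h => hj.2 hi h⟩

lemma exists_greatest [Finite ι] (γ : BlockComposition ι) {D : Set ι} (hD : D.Nonempty) :
    ∃ j ∈ D, ∀ i ∈ D, γ.le i j := by
  let r : Preorder ι :=
    { le := γ.le
      le_refl := γ.le_refl
      le_trans := γ.trans }
  obtain ⟨j, hj⟩ := D.toFinite.exists_maximal hD
  exact ⟨j, hj.1, fun i hi => (γ.total i j).elim id fun h => hj.2 hi h⟩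

lemma ncard_div_le {n : ℕ} {A B : Set (Fin n)} (h : A ⊆ B) :
    (A.ncard : ℝ) / n ≤ (B.ncard : ℝ) / n :=
  div_le_div_of_nonneg_right (by exact_mod_cast Set.ncard_le_ncard h) (by positivity)

/-- Down-sets are the unions of initial blocks, so their relative sizes are the cut points `N_i /
n`. -/
lemma mem_gap_toOpenSub {n : ℕ} (hn : 0 < n) (γ : BlockComposition (Fin n)) {c : ℝ} :
    c ∈ γ.toOpenSub.gap ↔ ∃ D, γ.IsDown D ∧ (D.ncard : ℝ) / n = c := by
  have hn' : (0 : ℝ) < n := by exact_mod_cast hn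
  constructor
  · rintro ⟨⟨h0, h1⟩, hc⟩
    have hc' : ∀ j, ({i | γ.Lt i j}.ncard : ℝ) / n < c → c < ({i | γ.le i j}.ncard : ℝ) / n →
        False := fun j ha hb => hc (mem_iUnion.2 ⟨j, ha, hb⟩)
    -- `D` collects the blocks ending at or before `c`. As `c` lies in no block interval, the first
    -- block outside `D` starts at or after `c`, which forces `|D| / n = c`.
    set D : Set (Fin n) := {j | ({i | γ.le i j}.ncard : ℝ) / n ≤ c} with hDdef
    have hmono : ∀ i j, γ.le i j →
        ({k | γ.le k i}.ncard : ℝ) / n ≤ ({k | γ.le k j}.ncard : ℝ) / n := fun i j hij =>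
      ncard_div_le fun k hk => γ.trans _ _ _ hk hij
    have hD : γ.IsDown D := fun i hi j hj => (hmono j i hj).trans hi
    refine ⟨D, hD, le_antisymm ?_ ?_⟩
    · rcases D.eq_empty_or_nonempty with h | h
      · simpa [h] using h0
      · obtain ⟨j, hj, hmax⟩ := γ.exists_greatest h
        exact (ncard_div_le hmax).trans hj
    · rcases Dᶜ.eq_empty_or_nonempty with h | h
      · rw [compl_empty_iff.1 h, Set.ncard_univ, Nat.card_fin, div_self hn'.ne']
        exact h1
      · obtain ⟨j, hj, hmin⟩ := γ.exists_least h
        have hb : c < ({i | γ.le i j}.ncard : ℝ) / n := not_le.1 hj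
        have ha : c ≤ ({i | γ.Lt i j}.ncard : ℝ) / n := not_lt.1 fun ha => hc' j ha hb
        refine ha.trans (ncard_div_le fun i hi => ?_)
        by_contra hiD
        exact hi (hmin i hiD)
  · rintro ⟨D, hD, rfl⟩
    refine ⟨⟨by positivity, ?_⟩, ?_⟩
    · refine div_le_one_of_le₀ ?_ (by positivity)
      exact_mod_cast (Set.ncard_le_card _).trans_eq (Nat.card_fin n)
    · intro h
      obtain ⟨j, h1, h2⟩ := mem_iUnion.1 h
      rw [div_lt_div_iff_of_pos_right hn', Nat.cast_lt] at h1 h2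
      by_cases hj : j ∈ D
      · exact absurd h2 (not_lt.2 (Set.ncard_le_ncard fun i hi => hD j hj i hi))
      · refine absurd h1 (not_lt.2 (Set.ncard_le_ncard fun i hi h' => hj (hD i hi j h')))

lemma dist_toOpenSub_le {n : ℕ} (hn : 0 < n) {γ : BlockComposition (Fin n)} {U : OpenSub} {r : ℝ}
    (hr : 0 ≤ r) (h₁ : ∀ D, γ.IsDown D → ∃ c ∈ U.gap, |(D.ncard : ℝ) / n - c| ≤ r)
    (h₂ : ∀ c ∈ U.gap, ∃ D, γ.IsDown D ∧ |(D.ncard : ℝ) / n - c| ≤ r) :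
    dist γ.toOpenSub U ≤ r := by
  refine OpenSub.dist_le_of_gap hr ?_ ?_
  · intro c hc
    obtain ⟨D, hD, rfl⟩ := (mem_gap_toOpenSub hn γ).1 hc
    exact h₁ D hD
  · intro c hc
    obtain ⟨D, hD, h⟩ := h₂ c hc
    exact ⟨_, (mem_gap_toOpenSub hn γ).2 ⟨D, hD, rfl⟩, by rwa [abs_sub_comm]⟩

lemma toOpenSub_comap {n : ℕ} (γ : BlockComposition (Fin n)) {f : Fin n → Fin n}
    (hf : Function.Injective f) : (γ.comap f).toOpenSub = γ.toOpenSub := by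
  have hbij : Function.Bijective f := Finite.injective_iff_bijective.1 hf
  have hcard : ∀ S : Set (Fin n), (f ⁻¹' S).ncard = S.ncard := fun S =>
    Set.ncard_preimage_of_injective_subset_range hf (by rw [hbij.2.range_eq]; exact subset_univ _)
  ext1
  refine iUnion_congr_of_surjective f hbij.2 fun j => ?_
  rw [← hcard, ← hcard {i | γ.le i (f j)}]
  rfl

/-! ### Asymptotic open sets -/

/-- The composition of the labels `n, n + 1, …`. -/
def shift (n : ℕ) (γ : BlockComposition ℕ) : BlockComposition ℕ := γ.comap (· + n)

lemma measurable_shift (n : ℕ) : Measurable (shift n) := measurable_comap _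

/-- Deleting `n` of `N + n` labels changes the relative size of any set of labels by at most `n / (N
+ n)`. -/
lemma dist_toOpenSub_shift_le {N : ℕ} (hN : 0 < N) (n : ℕ) (γ : BlockComposition ℕ) :
    dist ((γ.shift n).restr N).toOpenSub (γ.restr (N + n)).toOpenSub ≤ (n : ℝ) / (N + n : ℕ) := by
  have hN' : (0 : ℝ) < N := by exact_mod_cast hN
  let f : Fin N → Fin (N + n) := fun i => i.addNat n
  have hf : Function.Injective f := fun i j h => by simpa [f] using h
  have key : ∀ D : Set (Fin (N + n)),
      |((f ⁻¹' D).ncard : ℝ) / N - (D.ncard : ℝ) / (N + n : ℕ)| ≤ (n : ℝ) / (N + n : ℕ) := by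
    intro D
    have h1 : (f ⁻¹' D).ncard ≤ D.ncard := by
      rw [← Set.ncard_image_of_injective _ hf]
      exact Set.ncard_le_ncard (image_preimage_subset _ _)
    have h2 : D.ncard ≤ (f ⁻¹' D).ncard + n := by
      calc D.ncard ≤ (f '' (f ⁻¹' D) ∪ range (fun i : Fin n => (⟨i, by omega⟩ : Fin (N + n)))).ncard := by
            refine Set.ncard_le_ncard fun i hi => ?_
            by_cases hin : (i : ℕ) < n
            · exact Or.inr ⟨⟨i, hin⟩, rfl⟩
            · have : f ⟨i - n, by omega⟩ = i := by ext; simp [f]; omega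
              exact Or.inl ⟨⟨i - n, by omega⟩, by rwa [mem_preimage, this], this⟩
        _ ≤ _ := (Set.ncard_union_le _ _).trans ?_
      gcongr
      · exact (Set.ncard_image_of_injective _ hf).le
      · rw [← image_univ]
        exact (Set.ncard_image_le finite_univ).trans (by simp)
    have h3 : (f ⁻¹' D).ncard ≤ N := (Set.ncard_le_card _).trans_eq (Nat.card_fin N)
    have h1' : ((f ⁻¹' D).ncard : ℝ) ≤ D.ncard := by exact_mod_cast h1
    have h2' : (D.ncard : ℝ) ≤ (f ⁻¹' D).ncard + n := by exact_mod_cast h2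
    have h3' : ((f ⁻¹' D).ncard : ℝ) ≤ N := by exact_mod_cast h3
    have h4 : (0 : ℝ) ≤ (f ⁻¹' D).ncard := by positivity
    have hn0 : (0 : ℝ) ≤ n := by positivity
    push_cast
    rw [div_sub_div _ _ hN'.ne' (by positivity), abs_div, abs_of_pos (show (0 : ℝ) < N * (N + n) by positivity),
      div_le_div_iff₀ (by positivity) (by positivity), ← mul_assoc]
    gcongr
    rw [abs_le]
    constructor <;> nlinarith
  refine dist_toOpenSub_le hN (by positivity) ?_ ?_
  · intro D hD
    -- The down-closure of `D` among all `N + n` labels; its trace on the shifted labels is `D`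
    -- again because `D` is already a down-set there.
    let D' : Set (Fin (N + n)) := {i | ∃ j ∈ D, γ.le i (f j)}
    have hD' : (γ.restr (N + n)).IsDown D' := fun i ⟨j, hj, hij⟩ k hk =>
      ⟨j, hj, γ.trans _ _ _ hk hij⟩
    have hfD : f ⁻¹' D' = D := by
      ext i
      exact ⟨fun ⟨j, hj, hij⟩ => hD j hj i hij, fun hi => ⟨i, hi, γ.le_refl _⟩⟩
    refine ⟨_, (mem_gap_toOpenSub (by omega) _).2 ⟨D', hD', rfl⟩, ?_⟩
    rw [← hfD]
    exact key D'
  · intro c hc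
    obtain ⟨D, hD, rfl⟩ := (mem_gap_toOpenSub (by omega) _).1 hc
    exact ⟨f ⁻¹' D, fun i hi j hj => hD _ hi _ hj, key D⟩

lemma hasAsympOpen_shift {n : ℕ} {γ : BlockComposition ℕ} {U : OpenSub} :
    (γ.shift n).HasAsympOpen U ↔ γ.HasAsympOpen U := by
  unfold HasAsympOpen
  rw [← tendsto_add_atTop_iff_nat (f := fun n => (γ.restr n).toOpenSub) n]
  refine tendsto_iff_of_dist ?_
  refine squeeze_zero' (.of_forall fun _ => dist_nonneg)
    ((eventually_gt_atTop 0).mono fun N hN => dist_toOpenSub_shift_le hN n γ) ?_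
  exact (tendsto_const_div_atTop_nhds_zero_nat (n : ℝ)).comp (tendsto_add_atTop_nat n)

/-- Once `N` exceeds the support of `σ`, the first `N` labels are permuted among themselves and the
block sizes are unchanged. -/
lemma hasAsympOpen_permute {σ : Equiv.Perm ℕ} (hσ : {i | σ i ≠ i}.Finite) {γ : BlockComposition ℕ}
    {U : OpenSub} : (γ.permute σ).HasAsympOpen U ↔ γ.HasAsympOpen U := by
  obtain ⟨M, hM⟩ := hσ.bddAbove
  suffices h : ∀ N, M < N → ((γ.permute σ).restr N).toOpenSub = (γ.restr N).toOpenSub from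
    tendsto_congr' ((eventually_gt_atTop M).mono h)
  intro N hN
  have hlt : ∀ i, i < N → σ.symm i < N := by
    intro i hi
    by_contra! h
    have : σ (σ.symm i) = σ.symm i := by
      by_contra h'
      have := hM h'
      omega
    rw [Equiv.apply_symm_apply] at this
    omega
  let f : Fin N → Fin N := fun i => ⟨σ.symm i, hlt i i.2⟩
  have hf : Function.Injective f := fun i j h => by
    have : σ.symm i = σ.symm j := congrArg Fin.val h
    exact Fin.ext (σ.symm.injective this)
  have hN : (γ.permute σ).restr N = (γ.restr N).comap f := rfl
  rw [hN, toOpenSub_comap (γ.restr N) hf]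

open Classical in
/-- The asymptotic open set of `γ`, with the value `]0,1[` if there is none. -/
noncomputable def asymp (γ : BlockComposition ℕ) : OpenSub :=
  if h : ∃ U, γ.HasAsympOpen U then h.choose else OpenSub.one

lemma HasAsympOpen.asymp_eq {γ : BlockComposition ℕ} {U : OpenSub} (h : γ.HasAsympOpen U) :
    γ.asymp = U := by
  have hex : ∃ U, γ.HasAsympOpen U := ⟨U, h⟩
  rw [asymp, dif_pos hex]
  exact tendsto_nhds_unique hex.choose_spec h

lemma asymp_eq_one {γ : BlockComposition ℕ} (h : ¬ ∃ U, γ.HasAsympOpen U) :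
    γ.asymp = OpenSub.one := by rw [asymp, dif_neg h]

lemma asymp_congr {γ γ' : BlockComposition ℕ} (h : ∀ U, γ.HasAsympOpen U ↔ γ'.HasAsympOpen U) :
    γ.asymp = γ'.asymp := by
  by_cases hex : ∃ U, γ.HasAsympOpen U
  · obtain ⟨U, hU⟩ := hex
    rw [hU.asymp_eq, ((h U).1 hU).asymp_eq]
  · rw [asymp_eq_one hex, asymp_eq_one (by simpa [h] using hex)]

lemma asymp_shift (n : ℕ) (γ : BlockComposition ℕ) : (γ.shift n).asymp = γ.asymp :=
  asymp_congr fun _ => hasAsympOpen_shift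

lemma asymp_permute {σ : Equiv.Perm ℕ} (hσ : {i | σ i ≠ i}.Finite) (γ : BlockComposition ℕ) :
    (γ.permute σ).asymp = γ.asymp := asymp_congr fun _ => hasAsympOpen_permute hσ

lemma measurable_toOpenSub_restr (n : ℕ) :
    Measurable fun γ : BlockComposition ℕ => (γ.restr n).toOpenSub :=
  Measurable.comp (g := toOpenSub) .of_discrete (measurable_restr n)

lemma measurableSet_exists_hasAsympOpen :
    MeasurableSet {γ : BlockComposition ℕ | ∃ U, γ.HasAsympOpen U} :=
  measurableSet_exists_tendsto measurable_toOpenSub_restr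

lemma measurable_asymp : Measurable asymp := by
  classical
  let C := {γ : BlockComposition ℕ | ∃ U, γ.HasAsympOpen U}
  refine measurable_of_tendsto_metrizable
    (f := fun n γ => if γ ∈ C then (γ.restr n).toOpenSub else OpenSub.one) (fun n => ?_) ?_
  · exact (measurable_toOpenSub_restr n).ite measurableSet_exists_hasAsympOpen measurable_const
  · refine tendsto_pi_nhds.2 fun γ => ?_
    by_cases h : γ ∈ C
    · simp only [h, if_true]
      obtain ⟨U, hU⟩ := h
      rw [hU.asymp_eq]
      exact hU
    · simp only [h, if_false, asymp_eq_one h]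
      exact tendsto_const_nhds

/-- This relies on the default value of `asymp` being `]0,1[`: any other value certifies that the
limit exists. -/
lemma setOf_asymp_ne_one : {γ : BlockComposition ℕ | ∃ U, U ≠ OpenSub.one ∧ γ.HasAsympOpen U} =
    asymp ⁻¹' {OpenSub.one}ᶜ := by
  ext γ
  constructor
  · rintro ⟨U, hU, h⟩
    rwa [mem_preimage, h.asymp_eq]
  · intro h
    by_cases hex : ∃ U, γ.HasAsympOpen U
    · obtain ⟨U, hU⟩ := hex
      rw [mem_preimage, hU.asymp_eq] at h
      exact ⟨U, h, hU⟩
    · exact absurd (asymp_eq_one hex) h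

lemma toOpenSub_one {n : ℕ} (hn : 0 < n) :
    (one : BlockComposition (Fin n)).toOpenSub = OpenSub.one := by
  have : Nonempty (Fin n) := ⟨⟨0, hn⟩⟩
  have hn' : (n : ℝ) ≠ 0 := by positivity
  ext1
  simp [toOpenSub, one, Lt, OpenSub.one, Set.ncard_univ, hn', iUnion_const]

lemma hasAsympOpen_one : (one : BlockComposition ℕ).HasAsympOpen OpenSub.one := by
  refine tendsto_const_nhds.congr' ((eventually_gt_atTop 0).mono fun n hn => ?_)
  exact (toOpenSub_one hn).symm

lemma asymp_one : (one : BlockComposition ℕ).asymp = OpenSub.one := hasAsympOpen_one.asymp_eq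

end BlockComposition

/-! ### Compositions painted by uniform points -/

open BlockComposition

namespace OpenSub

/-- The law of a sequence of independent uniform points of `[0,1]`. -/
noncomputable def unif : Measure (ℕ → unitInterval) :=
  Measure.infinitePi fun _ : ℕ => (volume : Measure unitInterval)

instance : IsProbabilityMeasure unif := by unfold unif; infer_instance

lemma same_iff_of_le {U : OpenSub} {x y : ℝ} (hxy : x ≤ y) :
    U.Same x y ↔ Icc x y ⊆ U.carrier := by
  refine ⟨fun h z hz => connectedComponentIn_subset _ _ (h.of_mem hz).2, fun h => ?_⟩
  exact ⟨h ⟨le_rfl, hxy⟩, isPreconnected_Icc.subset_connectedComponentIn ⟨le_rfl, hxy⟩ h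
    ⟨hxy, le_rfl⟩⟩

lemma exists_mem_gap_of_not_same {U : OpenSub} {x y : ℝ} (hxy : x ≤ y) (hx : 0 ≤ x) (hy : y ≤ 1)
    (h : ¬ U.Same x y) : ∃ c ∈ U.gap, c ∈ Icc x y := by
  rw [same_iff_of_le hxy, not_subset] at h
  obtain ⟨c, hc, hcU⟩ := h
  exact ⟨c, ⟨⟨hx.trans hc.1, hc.2.trans hy⟩, hcU⟩, hc⟩

lemma not_same_of_mem_gap {U : OpenSub} {x y c : ℝ} (hc : c ∈ U.gap) (hxy : c ∈ Icc x y) :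
    ¬ U.Same x y := fun h => hc.2 ((same_iff_of_le (hxy.1.trans hxy.2)).1 h hxy)

lemma isOpen_setOf_same (U : OpenSub) : IsOpen {p : ℝ × ℝ | U.Same p.1 p.2} := by
  refine isOpen_iff_mem_nhds.2 fun p hp => ?_
  have hC : IsOpen (connectedComponentIn U.carrier p.1) := U.isOpen.connectedComponentIn
  refine mem_of_superset ((hC.prod hC).mem_nhds ⟨mem_connectedComponentIn hp.1, hp.2⟩) ?_
  rintro q ⟨h1, h2⟩
  exact ⟨connectedComponentIn_subset _ _ h1, connectedComponentIn_eq h1 ▸ h2⟩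

lemma measurable_paint (U : OpenSub) : Measurable U.paint := by
  refine measurable_iff.2 fun i j => ?_
  have h1 : MeasurableSet {X : ℕ → unitInterval | X i ≤ X j} :=
    measurableSet_le (measurable_pi_apply i) (measurable_pi_apply j)
  have h2 : Measurable fun X : ℕ → unitInterval => ((X i : ℝ), (X j : ℝ)) :=
    (measurable_subtype_coe.comp (measurable_pi_apply i)).prodMk
      (measurable_subtype_coe.comp (measurable_pi_apply j))
  exact h1.union (h2 U.isOpen_setOf_same.measurableSet)

lemma paintLaw_apply (U : OpenSub) {S : Set (BlockComposition ℕ)} (hS : MeasurableSet S) :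
    U.paintLaw S = unif (U.paint ⁻¹' S) := Measure.map_apply U.measurable_paint hS

instance (U : OpenSub) : IsProbabilityMeasure U.paintLaw :=
  Measure.isProbabilityMeasure_map U.measurable_paint.aemeasurable

/-! ### Empirical distributions -/

/-- The empirical distribution functions of the first `N` points, and their left limits, are at
distance at most `r` from the identity. -/
def UniformWithin (X : ℕ → unitInterval) (N : ℕ) (r : ℝ) : Prop :=
  ∀ c ∈ Icc (0 : ℝ) 1, ({i : Fin N | (X i : ℝ) ≤ c}.ncard : ℝ) / N ≤ c + r ∧
    c - r ≤ ({i : Fin N | (X i : ℝ) < c}.ncard : ℝ) / N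

lemma UniformWithin.abs_sub_le {X : ℕ → unitInterval} {N : ℕ} {r : ℝ} (h : UniformWithin X N r)
    {c : ℝ} (hc : c ∈ Icc (0 : ℝ) 1) {D : Set (Fin N)} (h₁ : {i : Fin N | (X i : ℝ) < c} ⊆ D)
    (h₂ : D ⊆ {i : Fin N | (X i : ℝ) ≤ c}) : |(D.ncard : ℝ) / N - c| ≤ r := by
  have := ncard_div_le h₁
  have := ncard_div_le h₂
  have := h c hc
  rw [abs_le]
  constructor <;> linarith

/-- Between the last point of a proper nonempty down-set and the first point outside it lies a gap
point `c`, whence `|D| / N` is within `r` of `c`. Conversely the labels with `X i < c` form a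
down-set for each gap point `c`. -/
lemma dist_paint_le (U : OpenSub) {X : ℕ → unitInterval} {N : ℕ} (hN : 0 < N) {r : ℝ} (hr : 0 ≤ r)
    (h : UniformWithin X N r) : dist ((U.paint X).restr N).toOpenSub U ≤ r := by
  refine dist_toOpenSub_le hN hr ?_ ?_
  · intro D hD
    rcases D.eq_empty_or_nonempty with rfl | hne
    · exact ⟨0, U.zero_mem_gap, by simpa⟩
    rcases Dᶜ.eq_empty_or_nonempty with hc | hne'
    · refine ⟨1, U.one_mem_gap, ?_⟩
      have : (N : ℝ) ≠ 0 := by positivity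
      rw [compl_empty_iff.1 hc, Set.ncard_univ, Nat.card_fin, div_self this]
      simpa
    obtain ⟨i, hi, hmax⟩ := Set.exists_max_image D (fun i => X i) D.toFinite hne
    obtain ⟨j, hj, hmin⟩ := Set.exists_min_image Dᶜ (fun i => X i) Dᶜ.toFinite hne'
    have hji : ¬ (U.paint X).le j i := fun h => hj (hD i hi j h)
    have hji' : ¬ (X j ≤ X i ∨ U.Same (X j) (X i)) := hji
    obtain ⟨h1, h2⟩ := not_or.1 hji'
    have hlt : (X i : ℝ) ≤ X j := (not_le.1 h1).le
    obtain ⟨c, hc, hc'⟩ := exists_mem_gap_of_not_same hlt (X i).2.1 (X j).2.2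
      fun h => h2 h.symm
    refine ⟨c, hc, h.abs_sub_le hc.1 (fun k hk => ?_) fun k hk => ?_⟩
    · by_contra hkD
      have : (X j : ℝ) ≤ X k := hmin k hkD
      exact absurd hk (not_lt.2 (hc'.2.trans this))
    · have : (X k : ℝ) ≤ X i := hmax k hk
      exact this.trans hc'.1
  · intro c hc
    refine ⟨{i | (X i : ℝ) < c}, ?_, h.abs_sub_le hc.1 subset_rfl fun i (hi : (X i : ℝ) < c) => hi.le⟩
    intro i hi j hji
    have hi' : (X i : ℝ) < c := hi
    have hji' : X j ≤ X i ∨ U.Same (X j) (X i) := hji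
    rcases hji' with h | h
    · exact lt_of_le_of_lt (b := (X i : ℝ)) h hi'
    · by_contra hjc
      exact not_same_of_mem_gap hc ⟨hi'.le, not_lt.1 hjc⟩ h.symm

lemma ae_tendsto_empirical (c : unitInterval) : ∀ᵐ X ∂unif,
    Tendsto (fun N : ℕ => ({i : Fin N | X i ≤ c}.ncard : ℝ) / N) atTop (𝓝 c) := by
  classical
  let f : unitInterval → ℝ := (Iic c).indicator 1
  have hf : Measurable f := measurable_one.indicator measurableSet_Iic
  have hfi : ∀ i, Measurable fun X : ℕ → unitInterval => f (X i) := fun i =>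
    hf.comp (measurable_pi_apply i)
  have hb : Integrable (fun X : ℕ → unitInterval => f (X 0)) unif := by
    refine Integrable.of_bound (hfi 0).aestronglyMeasurable 1 (.of_forall fun X => ?_)
    simp only [f, indicator]
    split_ifs <;> simp
  have hind : ProbabilityTheory.iIndepFun (fun (i : ℕ) (X : ℕ → unitInterval) => f (X i)) unif :=
    ProbabilityTheory.iIndepFun_infinitePi (X := fun _ => f) fun _ => hf
  have hmap : ∀ i, unif.map (fun X => X i) = volume := fun i =>
    Measure.infinitePi_map_eval (fun _ : ℕ => (volume : Measure unitInterval)) i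
  have key := ProbabilityTheory.strong_law_ae_real (μ := unif)
    (fun (i : ℕ) (X : ℕ → unitInterval) => f (X i)) hb
    (fun i j hij => hind.indepFun hij) (fun i => ⟨(hfi i).aemeasurable, (hfi 0).aemeasurable, by
      have : ∀ i, unif.map (fun X => f (X i)) = volume.map f := fun i => by
        rw [← hmap i, Measure.map_map hf (measurable_pi_apply i)]; rfl
      rw [this, this]⟩)
  have hint : ∫ X, f (X 0) ∂unif = c := by
    have : ∫ X, f (X 0) ∂unif = ∫ x, f x ∂(unif.map fun X => X 0) :=
      (integral_map (measurable_pi_apply 0).aemeasurable hf.aestronglyMeasurable).symm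
    rw [this, hmap, integral_indicator_one measurableSet_Iic, Measure.real,
      unitInterval.volume_Iic, ENNReal.toReal_ofReal c.2.1]
  rw [hint] at key
  filter_upwards [key] with X hX
  refine hX.congr fun N => ?_
  congr 1
  rw [← Fin.sum_univ_eq_sum_range (fun i => f (X i)), Set.ncard_eq_toFinset_card',
    Finset.card_eq_sum_ones]
  push_cast
  rw [Set.toFinset_ofPred, Finset.sum_filter]
  exact Finset.sum_congr rfl fun i _ => by simp [f, indicator]

/-- Distribution functions are monotone, so control at the points `k / K` costs only the mesh `1 /
K` in between. -/
lemma uniformWithin_of_grid {X : ℕ → unitInterval} {N K : ℕ} (hK : 0 < K) {ε : ℝ} (hε : 0 ≤ ε)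
    (h : ∀ k ≤ K, |({i : Fin N | (X i : ℝ) ≤ (k : ℝ) / K}.ncard : ℝ) / N - (k : ℝ) / K| ≤ ε) :
    UniformWithin X N (1 / K + ε) := by
  have hK' : (0 : ℝ) < K := by exact_mod_cast hK
  rintro c ⟨hc0, hc1⟩
  have hk1 : c * K ≤ ⌈c * K⌉₊ := Nat.le_ceil _
  have hk2 : (⌈c * K⌉₊ : ℝ) < c * K + 1 := Nat.ceil_lt_add_one (by positivity)
  have hkK : ⌈c * K⌉₊ ≤ K := Nat.ceil_le.2 (by nlinarith)
  generalize ⌈c * K⌉₊ = k at hk1 hk2 hkK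
  have h1 : c ≤ k / K := (le_div_iff₀ hK').2 hk1
  have h2 : (k : ℝ) / K < c + 1 / K := by
    rw [div_lt_iff₀ hK', add_mul, one_div, inv_mul_cancel₀ hK'.ne']; exact hk2
  constructor
  · have := ncard_div_le (A := {i : Fin N | (X i : ℝ) ≤ c})
      (B := {i : Fin N | (X i : ℝ) ≤ (k : ℝ) / K}) fun i hi => le_trans hi h1
    have := (abs_le.1 (h k hkK)).2
    linarith
  · rcases Nat.eq_zero_or_pos k with rfl | hk
    · have : c = 0 := by
        have : c ≤ 0 := by simpa using h1
        linarith
      have h3 : (0 : ℝ) ≤ ({i : Fin N | (X i : ℝ) < c}.ncard : ℝ) / N := by positivity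
      have h4 : (0 : ℝ) ≤ 1 / K := by positivity
      linarith
    -- The grid point before the rounded-up one is strictly below `c`, as the strict inequality in
    -- the left limit requires.
    · have h3 : ((k - 1 : ℕ) : ℝ) / K = k / K - 1 / K := by
        rw [Nat.cast_sub (by omega)]; push_cast; ring
      have := ncard_div_le (A := {i : Fin N | (X i : ℝ) ≤ ((k - 1 : ℕ) : ℝ) / K})
        (B := {i : Fin N | (X i : ℝ) < c}) fun i hi => by
          have hi' : (X i : ℝ) ≤ ((k - 1 : ℕ) : ℝ) / K := hi
          rw [h3] at hi'
          exact show (X i : ℝ) < c by linarith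
      have := (abs_le.1 (h (k - 1) (by omega))).1
      linarith

/-- Glivenko–Cantelli: the strong law holds simultaneously at countably many grid points. -/
lemma ae_uniformWithin : ∀ᵐ X ∂unif, ∀ ε > 0, ∀ᶠ N in atTop, UniformWithin X N ε := by
  have h : ∀ᵐ X ∂unif, ∀ K k : ℕ, ∀ h : 0 < K ∧ k ≤ K, Tendsto (fun N : ℕ =>
      ({i : Fin N | (X i : ℝ) ≤ (k : ℝ) / K}.ncard : ℝ) / N) atTop (𝓝 ((k : ℝ) / K)) := by
    refine ae_all_iff.2 fun K => ae_all_iff.2 fun k => ?_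
    by_cases h : 0 < K ∧ k ≤ K
    · have hm : (k : ℝ) / K ∈ Icc (0 : ℝ) 1 :=
        ⟨by positivity, div_le_one_of_le₀ (by exact_mod_cast h.2) (by positivity)⟩
      filter_upwards [ae_tendsto_empirical ⟨(k : ℝ) / K, hm⟩] with X hX _
      exact hX
    · exact .of_forall fun X h' => absurd h' h
  filter_upwards [h] with X hX ε hε
  obtain ⟨K, hK⟩ := exists_nat_gt (2 / ε)
  have hK0 : (0 : ℝ) < K := lt_trans (by positivity) hK
  have hKpos : 0 < K := by exact_mod_cast hK0
  have h1 : ∀ᶠ N : ℕ in atTop, ∀ k ∈ Finset.range (K + 1),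
      |({i : Fin N | (X i : ℝ) ≤ (k : ℝ) / K}.ncard : ℝ) / N - (k : ℝ) / K| ≤ ε / 2 := by
    refine (Finset.eventually_all _).2 fun k hk => ?_
    have := hX K k ⟨hKpos, by simpa [Nat.lt_succ_iff] using hk⟩
    filter_upwards [Metric.tendsto_nhds.1 this (ε / 2) (by positivity)] with N hN
    exact hN.le
  filter_upwards [h1] with N hN
  have h2 := uniformWithin_of_grid hKpos (by positivity) fun k hk =>
    hN k (Finset.mem_range.2 (by omega))
  have h3 : 1 / (K : ℝ) + ε / 2 ≤ ε := by
    have : 1 / (K : ℝ) < ε / 2 := by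
      rw [div_lt_iff₀ hK0]
      rw [div_lt_iff₀ hε] at hK
      linarith
    linarith
  intro c hc
  have := h2 c hc
  constructor <;> linarith

lemma ae_hasAsympOpen_paint (U : OpenSub) : ∀ᵐ X ∂unif, (U.paint X).HasAsympOpen U := by
  filter_upwards [ae_uniformWithin] with X hX
  refine Metric.tendsto_nhds.2 fun ε hε => ?_
  filter_upwards [hX (ε / 2) (by positivity), eventually_gt_atTop 0] with N hN hN0
  exact (U.dist_paint_le hN0 (by positivity) hN).trans_lt (half_lt_self hε)

/-- A painted composition remembers its paintbox; this later identifies the mixing measure. -/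
lemma ae_asymp_eq (U : OpenSub) : ∀ᵐ γ ∂U.paintLaw, γ.asymp = U := by
  refine (ae_map_iff U.measurable_paint.aemeasurable ?_).2 ?_
  · exact measurable_asymp (measurableSet_singleton U)
  · filter_upwards [U.ae_hasAsympOpen_paint] with X hX
    exact hX.asymp_eq

lemma ae_exists_hasAsympOpen (U : OpenSub) : ∀ᵐ γ ∂U.paintLaw, ∃ V, γ.HasAsympOpen V := by
  refine (ae_map_iff U.measurable_paint.aemeasurable measurableSet_exists_hasAsympOpen).2 ?_
  filter_upwards [U.ae_hasAsympOpen_paint] with X hX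
  exact ⟨U, hX⟩

/-! ### Continuity of the law of a painted composition -/

lemma ae_notMem_of_countable {S : Set ℝ} (hS : S.Countable) :
    ∀ᵐ X ∂unif, ∀ i, (X i : ℝ) ∉ S := by
  refine ae_all_iff.2 fun i => ?_
  have h1 : ∀ᵐ x : unitInterval, (x : ℝ) ∉ S := by
    rw [ae_iff]
    simp only [not_not]
    exact (hS.preimage Subtype.val_injective).measure_zero _
  exact (measurePreserving_eval_infinitePi (fun _ : ℕ => (volume : Measure unitInterval))
    i).quasiMeasurePreserving.ae h1

/-- The points of the complement of `U` which are isolated on at least one side. -/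
def isolated (U : OpenSub) : Set ℝ :=
  {x ∈ U.gap | 𝓝[U.gap ∩ Ioi x] x = ⊥} ∪ {x ∈ U.gap | 𝓝[U.gap ∩ Iio x] x = ⊥}

lemma countable_isolated (U : OpenSub) : U.isolated.Countable :=
  countable_setOfPred_isolated_right_within.union countable_setOfPred_isolated_left_within

/-- If the only gap points in `[x,y]` were endpoints, such an endpoint would be isolated on one
side. A strictly interior gap point is what makes separation stable under perturbation of `U`. -/
lemma exists_mem_gap_Ioo {U : OpenSub} {x y : ℝ} (hxy : x < y) (hx : 0 ≤ x) (hy : y ≤ 1)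
    (hxi : x ∉ U.isolated) (hyi : y ∉ U.isolated) (h : ¬ U.Same x y) :
    ∃ c ∈ U.gap, c ∈ Ioo x y := by
  obtain ⟨c, hc, hcx, hcy⟩ := exists_mem_gap_of_not_same hxy.le hx hy h
  by_contra! h'
  rcases hcx.eq_or_lt with rfl | hcx
  · refine hxi (Or.inl ⟨hc, ?_⟩)
    rw [← empty_mem_iff_bot, mem_nhdsWithin]
    exact ⟨Iio y, isOpen_Iio, hxy, fun z hz => h' z hz.2.1 ⟨hz.2.2, hz.1⟩⟩
  rcases hcy.eq_or_lt with rfl | hcy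
  · refine hyi (Or.inr ⟨hc, ?_⟩)
    rw [← empty_mem_iff_bot, mem_nhdsWithin]
    exact ⟨Ioi x, isOpen_Ioi, hxy, fun z hz => h' z hz.2.1 ⟨hz.1, hz.2.2⟩⟩
  · exact h' c hc ⟨hcx, hcy⟩

/-- If `x`, `y` are joined, `chi` has a positive minimum on `[x,y]`, which survives small
perturbations. If separated, an interior gap point of `U` has a nearby gap point of `V`, still
between `x` and `y`. -/
lemma eventually_same_iff {U : OpenSub} {x y : unitInterval} (hxy : x < y)
    (hx : (x : ℝ) ∉ U.isolated) (hy : (y : ℝ) ∉ U.isolated) :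
    ∀ᶠ V in 𝓝 U, V.Same x y ↔ U.Same x y := by
  have hxy' : (x : ℝ) < y := hxy
  by_cases h : U.Same x y
  · have hsub := (same_iff_of_le hxy'.le).1 h
    obtain ⟨z, hz, hmin⟩ := isCompact_Icc.exists_isMinOn (s := Icc x y) ⟨x, le_rfl, hxy.le⟩
      U.chi.continuous.continuousOn
    have hpos : 0 < U.chi z := (U.chi_pos_iff z).2 (hsub hz)
    filter_upwards [Metric.ball_mem_nhds U hpos] with V hV
    refine iff_of_true ((same_iff_of_le hxy'.le).2 fun w hw => ?_) h
    let w' : unitInterval := ⟨w, x.2.1.trans hw.1, hw.2.trans y.2.2⟩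
    refine (V.chi_pos_iff w').1 ?_
    have h1 := abs_le.1 (abs_chi_sub_le V U w')
    have h2 : U.chi z ≤ U.chi w' := hmin (show w' ∈ Icc x y from hw)
    have h3 : dist V U < U.chi z := hV
    linarith
  · obtain ⟨c, hc, hcx, hcy⟩ := exists_mem_gap_Ioo hxy' x.2.1 y.2.2 hx hy h
    have hδ : 0 < min (c - x) (y - c) := lt_min (by linarith) (by linarith)
    filter_upwards [Metric.ball_mem_nhds U hδ] with V hV
    refine iff_of_false ?_ h
    let c' : unitInterval := ⟨c, hc.1⟩
    have h1 : V.chi c' < min (c - x) (y - c) := by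
      have h2 := abs_le.1 (abs_chi_sub_le V U c')
      have h3 : U.chi c' = 0 := by
        rw [chi_apply]; exact Metric.infDist_zero_of_mem hc
      have h4 : dist V U < min (c - x) (y - c) := hV
      linarith
    rw [chi_apply] at h1
    obtain ⟨d, hd, hcd⟩ := (Metric.infDist_lt_iff ⟨0, V.zero_mem_gap⟩).1 h1
    rw [Real.dist_eq, lt_min_iff, abs_lt, abs_lt] at hcd
    refine not_same_of_mem_gap hd ⟨?_, ?_⟩ <;> simp only [c'] at hcd <;> linarith

/-- Almost surely the sample avoids the countably many one-sidedly isolated gap points of `U`; then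
the first `n` labels are painted alike by all `V` near `U`, and the measures of the events converge.
-/
lemma continuous_paintLaw_apply {n : ℕ} (B : Set (BlockComposition (Fin n))) :
    Continuous fun U : OpenSub => U.paintLaw (restr n ⁻¹' B) := by
  have hB : MeasurableSet (restr n ⁻¹' B) := measurableSet_restr_preimage B
  refine continuous_iff_continuousAt.2 fun U => ?_
  simp only [ContinuousAt, paintLaw_apply _ hB]
  refine tendsto_measure_of_ae_tendsto_indicator_of_isFiniteMeasure _ (U.measurable_paint hB)
    (fun V => V.measurable_paint hB) ?_
  filter_upwards [ae_notMem_of_countable U.countable_isolated] with X hX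
  have h1 : ∀ i j : Fin n, ∀ᶠ V in 𝓝 U, (V.paint X).le i j ↔ (U.paint X).le i j := by
    intro i j
    by_cases hij : X i ≤ X j
    · exact .of_forall fun V => iff_of_true (Or.inl hij) (Or.inl hij)
    · filter_upwards [eventually_same_iff (not_le.1 hij) (hX j) (hX i)] with V hV
      refine or_congr Iff.rfl ⟨fun h => (hV.1 h.symm).symm, fun h => (hV.2 h.symm).symm⟩
  filter_upwards [eventually_all.2 fun i => eventually_all.2 (h1 i)] with V hV
  have : (V.paint X).restr n = (U.paint X).restr n :=
    BlockComposition.ext (by ext i j; exact hV i j)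
  simp only [mem_preimage, this]

lemma measurable_paintLaw : Measurable paintLaw := by
  refine Measurable.measure_of_isPiSystem_of_isProbabilityMeasure generateFrom_cylinders
    isPiSystem_cylinders ?_
  rintro _ ⟨n, B, rfl⟩
  exact (continuous_paintLaw_apply B).measurable

/-! ### Separation of two labels and the largest component -/

lemma volume_setOf_same_le (U : OpenSub) (x : unitInterval) :
    volume {y : unitInterval | U.Same x y} ≤ U.s1 := by
  by_cases hx : (x : ℝ) ∈ U.carrier
  · rw [unitInterval.volume_apply]
    refine le_trans (measure_mono ?_) (le_iSup₂ (f := fun x (_ : x ∈ U.carrier) =>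
      volume (connectedComponentIn U.carrier x)) (x : ℝ) hx)
    rintro _ ⟨y, hy, rfl⟩
    exact hy.2
  · have : {y : unitInterval | U.Same x y} = ∅ := by
      ext y
      exact iff_of_false (fun h => hx h.1) (notMem_empty _)
    simp [this]

lemma measurableSet_sim (i j : ℕ) : MeasurableSet {γ : BlockComposition ℕ | γ.Sim i j} :=
  (measurableSet_setOf_le i j).inter (measurableSet_setOf_le j i)

/-- By Fubini: given `X 0`, the point `X 1` must fall in the component of `X 0`, or coincide with `X
0`, a null event. -/
lemma paintLaw_sim_le (U : OpenSub) : U.paintLaw {γ | γ.Sim 0 1} ≤ U.s1 := by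
  rw [paintLaw_apply _ (measurableSet_sim 0 1)]
  let S : Set (unitInterval × unitInterval) := {p | p.1 = p.2 ∨ U.Same p.1 p.2}
  have hS : MeasurableSet S := by
    refine (measurableSet_eq_fun measurable_fst measurable_snd).union ?_
    have : Measurable fun p : unitInterval × unitInterval => ((p.1 : ℝ), (p.2 : ℝ)) := by fun_prop
    exact this U.isOpen_setOf_same.measurableSet
  calc unif (U.paint ⁻¹' {γ | γ.Sim 0 1}) ≤ unif ((fun X => (X 0, X 1)) ⁻¹' S) := by
        refine measure_mono fun X hX => ?_
        rcases hX with ⟨h1 | h1, h2 | h2⟩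
        · exact Or.inl (_root_.le_antisymm h1 h2)
        · exact Or.inr h2.symm
        · exact Or.inr h1
        · exact Or.inr h1
    _ = (volume.prod volume) S := by
        rw [← Measure.infinitePi_map_eval_prod (P := fun _ : ℕ => (volume : Measure unitInterval))
          zero_ne_one, Measure.map_apply (by fun_prop) hS]
        rfl
    _ = ∫⁻ x, volume (Prod.mk x ⁻¹' S) := Measure.prod_apply hS
    _ ≤ ∫⁻ _ : unitInterval, U.s1 := by
        refine lintegral_mono fun x => ?_
        calc volume (Prod.mk x ⁻¹' S) ≤ volume ({x} ∪ {y : unitInterval | U.Same x y}) := by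
              refine measure_mono fun y hy => ?_
              rcases hy with h | h
              · exact Or.inl (Eq.symm h)
              · exact Or.inr h
          _ ≤ volume {x} + volume {y : unitInterval | U.Same x y} := measure_union_le _ _
          _ ≤ _ := by simpa using U.volume_setOf_same_le x
    _ = U.s1 := by simp

lemma one_sub_s1_le (U : OpenSub) : 1 - U.s1 ≤ U.paintLaw {γ | ¬ γ.Sim 0 1} := by
  have : {γ : BlockComposition ℕ | ¬ γ.Sim 0 1} = {γ | γ.Sim 0 1}ᶜ := rfl
  rw [this, prob_compl_eq_one_sub (measurableSet_sim 0 1)]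
  exact tsub_le_tsub_left U.paintLaw_sim_le 1

end OpenSub

/-! ### Sampling labels -/

namespace OpenSub

/-- The label in `{0, …, N}` corresponding to a point of `[0,1]`. -/
noncomputable def label (N : ℕ) (x : unitInterval) : Fin (N + 1) :=
  -- The minimum with `N` only acts at `x = 1`.
  ⟨min ⌊(x : ℝ) * (N + 1 : ℕ)⌋₊ N, by omega⟩

lemma label_le (N : ℕ) (x : unitInterval) : (label N x : ℝ) ≤ x * (N + 1 : ℕ) := by
  have hx : (0 : ℝ) ≤ x * (N + 1 : ℕ) := mul_nonneg x.2.1 (by positivity)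
  calc (label N x : ℝ) ≤ (⌊(x : ℝ) * (N + 1 : ℕ)⌋₊ : ℝ) := by
        exact_mod_cast min_le_left _ _
    _ ≤ _ := Nat.floor_le hx

lemma le_label_add_one (N : ℕ) (x : unitInterval) :
    (x : ℝ) * (N + 1 : ℕ) ≤ (label N x : ℝ) + 1 := by
  have h1 : (x : ℝ) * (N + 1 : ℕ) < (⌊(x : ℝ) * (N + 1 : ℕ)⌋₊ : ℝ) + 1 := Nat.lt_floor_add_one _
  have h2 : (x : ℝ) * (N + 1 : ℕ) ≤ (N : ℝ) + 1 := by
    push_cast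
    exact mul_le_of_le_one_left (by positivity) x.2.2
  have h3 : (label N x : ℝ) = min (⌊(x : ℝ) * (N + 1 : ℕ)⌋₊ : ℝ) N := by
    simp only [label]; push_cast; rfl
  rw [h3]
  rcases min_choice (⌊(x : ℝ) * (N + 1 : ℕ)⌋₊ : ℝ) N with h | h <;> rw [h] <;> linarith

lemma label_mono (N : ℕ) : Monotone (label N) := by
  intro x y hxy
  have hxy' : (x : ℝ) ≤ y := hxy
  change min ⌊(x : ℝ) * (N + 1 : ℕ)⌋₊ N ≤ min ⌊(y : ℝ) * (N + 1 : ℕ)⌋₊ N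
  gcongr

lemma measurable_label (N : ℕ) : Measurable (label N) := (label_mono N).measurable

lemma eq_label_of_lt {N : ℕ} {x : unitInterval} {a : Fin (N + 1)} (h₁ : (a : ℝ) ≤ x * (N + 1 : ℕ))
 
    (h₂ : (x : ℝ) * (N + 1 : ℕ) < (a : ℝ) + 1) : label N x = a := by
  ext
  have : ⌊(x : ℝ) * (N + 1 : ℕ)⌋₊ = (a : ℕ) :=
    (Nat.floor_eq_iff (mul_nonneg x.2.1 (by positivity))).2 ⟨h₁, h₂⟩
  simp only [label, this]
  omega

lemma volume_label_preimage (N : ℕ) (a : Fin (N + 1)) :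
    volume (label N ⁻¹' {a}) = ENNReal.ofReal (1 / (N + 1 : ℕ)) := by
  have hN : (0 : ℝ) < (N + 1 : ℕ) := by positivity
  have ha : ((a : ℕ) : ℝ) + 1 ≤ (N + 1 : ℕ) := by exact_mod_cast a.2
  let l : unitInterval := ⟨(a : ℝ) / (N + 1 : ℕ), by positivity,
    div_le_one_of_le₀ (by linarith) hN.le⟩
  let r : unitInterval := ⟨((a : ℝ) + 1) / (N + 1 : ℕ), by positivity, div_le_one_of_le₀ ha hN.le⟩
  have hlr : (r : ℝ) - l = 1 / (N + 1 : ℕ) := by simp only [l, r]; ring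
  apply le_antisymm
  · rw [← hlr, ← unitInterval.volume_Icc]
    refine measure_mono ?_
    rintro x rfl
    exact ⟨(div_le_iff₀ hN).2 (label_le N x), (le_div_iff₀ hN).2 (le_label_add_one N x)⟩
  · rw [← hlr, ← unitInterval.volume_Ioo]
    refine measure_mono ?_
    rintro x ⟨h1, h2⟩
    exact eq_label_of_lt ((div_lt_iff₀ hN).1 (show l.1 < x.1 from h1)).le
      ((lt_div_iff₀ hN).1 (show x.1 < r.1 from h2))

lemma map_label_perm (N : ℕ) (σ : Equiv.Perm (Fin (N + 1))) :
    (volume : Measure unitInterval).map (fun x => σ (label N x)) = volume.map (label N) := by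
  refine Measure.ext_of_singleton fun a => ?_
  have hm : Measurable fun x => σ (label N x) := Measurable.comp .of_discrete (measurable_label N)
  rw [Measure.map_apply hm (measurableSet_singleton a),
    Measure.map_apply (measurable_label N) (measurableSet_singleton a), volume_label_preimage]
  have : (fun x => σ (label N x)) ⁻¹' {a} = label N ⁻¹' {σ.symm a} := by
    ext x; simp [Equiv.eq_symm_apply]
  rw [this, volume_label_preimage]

lemma unif_label_perm (N : ℕ) (σ : Equiv.Perm (Fin (N + 1))) (S : Set (ℕ → Fin (N + 1)))
    (hS : MeasurableSet S) :
    unif {X | (fun i => σ (label N (X i))) ∈ S} = unif {X | (fun i => label N (X i)) ∈ S} := by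
  have hm : Measurable fun x => σ (label N x) := Measurable.comp .of_discrete (measurable_label N)
  have h1 : unif.map (fun X i => σ (label N (X i))) = unif.map (fun X i => label N (X i)) := by
    unfold unif
    rw [Measure.infinitePi_map_pi (f := fun _ x => σ (label N x)) _ fun _ => hm,
      Measure.infinitePi_map_pi (f := fun _ x => label N x) _ fun _ => measurable_label N]
    simp only [map_label_perm]
  have h2 := congrArg (fun ρ => ρ S) h1
  have hm₁ : Measurable fun (X : ℕ → unitInterval) i => σ (label N (X i)) :=
    measurable_pi_lambda _ fun i => hm.comp (measurable_pi_apply i)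
  have hm₂ : Measurable fun (X : ℕ → unitInterval) i => label N (X i) :=
    measurable_pi_lambda _ fun i => (measurable_label N).comp (measurable_pi_apply i)
  rwa [Measure.map_apply hm₁ hS, Measure.map_apply hm₂ hS] at h2

end OpenSub

namespace BlockComposition

open OpenSub

lemma exists_sort {n : ℕ} (γ : BlockComposition (Fin n)) :
    ∃ σ : Equiv.Perm (Fin n), ∀ a b, a ≤ b → γ.le (σ a) (σ b) := by
  let key : Fin n → ℕ := fun i => {k | γ.Lt k i}.ncard
  refine ⟨Tuple.sort key, fun a b hab => ?_⟩
  have h : key (Tuple.sort key a) ≤ key (Tuple.sort key b) := Tuple.monotone_sort key hab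
  by_contra hle
  refine absurd h (not_le.2 (Set.ncard_lt_ncard ⟨fun k hk hk' => ?_, fun hsub => ?_⟩))
  · exact hk (γ.trans _ _ _ ((γ.total _ _).resolve_left hle) hk')
  · exact hsub (show Tuple.sort key b ∈ {k | γ.Lt k (Tuple.sort key a)} from hle) (γ.le_refl _)

/-- Once `σ` lists the labels in block order, cell `a` of the regular grid belongs to label `σ a`,
and each block fills one interval of consecutive cells. Off the grid, lying in one component means
having labels in one block. -/
lemma paint_toOpenSub_le_iff {N : ℕ} {γ : BlockComposition (Fin (N + 1))}
    {σ : Equiv.Perm (Fin (N + 1))} (hσ : ∀ a b, a ≤ b → γ.le (σ a) (σ b)) {x y : unitInterval}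
    (hx : (x : ℝ) * (N + 1 : ℕ) ∉ range ((↑) : ℕ → ℝ))
    (hy : (y : ℝ) * (N + 1 : ℕ) ∉ range ((↑) : ℕ → ℝ)) :
    (x ≤ y ∨ γ.toOpenSub.Same x y) ↔ γ.le (σ (label N x)) (σ (label N y)) := by
  have hN : (0 : ℝ) < (N + 1 : ℕ) := by positivity
  by_cases hxy : x ≤ y
  · exact iff_of_true (Or.inl hxy) (hσ _ _ (label_mono N hxy))
  have hyx : y < x := not_le.1 hxy
  have hba : label N y ≤ label N x := label_mono N hyx.le
  have hxl : (x : ℝ) * (N + 1 : ℕ) < (label N x : ℝ) + 1 :=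
    lt_of_le_of_ne (le_label_add_one N x) fun h => hx ⟨label N x + 1, by rw [h]; push_cast; rfl⟩
  have hyl : (label N y : ℝ) < (y : ℝ) * (N + 1 : ℕ) :=
    lt_of_le_of_ne (label_le N y) fun h => hy ⟨label N y, h⟩
  constructor
  · rintro (h | h)
    · exact absurd h hxy
    by_contra hle
    -- The right end `|D| / (N + 1)` of the block of `y` is a gap point: `D` contains every `σ c`
    -- with `c ≤ label N y` and no `σ c` with `c ≥ label N x`, so this point separates `y` from `x`.
    let D : Set (Fin (N + 1)) := {i | γ.le i (σ (label N y))}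
    have hD : (D.ncard : ℝ) / (N + 1 : ℕ) ∈ γ.toOpenSub.gap :=
      (mem_gap_toOpenSub (by omega) γ).2 ⟨D, γ.isDown_setOf_le _, rfl⟩
    have h1 : (label N y : ℕ) + 1 ≤ D.ncard := by
      rw [← Fin.card_Iic, ← Set.ncard_coe_finset, ← Set.ncard_image_of_injective _ σ.injective]
      refine Set.ncard_le_ncard ?_
      rintro _ ⟨c, hc, rfl⟩
      exact hσ _ _ (by simpa using hc)
    have h2 : D.ncard ≤ label N x := by
      rw [← Fin.card_Iio, ← Set.ncard_coe_finset,
        ← Set.ncard_image_of_injective (↑(Finset.Iio (label N x))) σ.injective]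
      refine Set.ncard_le_ncard fun i hi => (mem_image _ _ _).2 ⟨σ.symm i, ?_, σ.apply_symm_apply i⟩
      rw [Finset.mem_coe, Finset.mem_Iio]
      by_contra hlt
      have hlt' : label N x ≤ σ.symm i := by simpa using hlt
      have := hσ _ _ hlt'
      rw [Equiv.apply_symm_apply] at this
      exact hle (γ.trans _ _ _ this hi)
    have h1' : (label N y : ℝ) + 1 ≤ D.ncard := by exact_mod_cast h1
    have h2' : (D.ncard : ℝ) ≤ label N x := by exact_mod_cast h2
    refine not_same_of_mem_gap hD ⟨?_, ?_⟩ h.symm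
    · exact (le_div_iff₀ hN).2 ((le_label_add_one N y).trans h1')
    · exact (div_le_iff₀ hN).2 (h2'.trans (label_le N x))
  · intro h
    right
    -- The open interval of the block of `j` covers `[y,x]`; strictness at both ends comes from `x`
    -- and `y` being off the grid.
    set j := σ (label N x) with hj
    have h1 : {i | γ.Lt i j}.ncard ≤ label N y := by
      rw [← Fin.card_Iio, ← Set.ncard_coe_finset,
        ← Set.ncard_image_of_injective (↑(Finset.Iio (label N y))) σ.injective]
      refine Set.ncard_le_ncard fun i hi => (mem_image _ _ _).2 ⟨σ.symm i, ?_, σ.apply_symm_apply i⟩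
      rw [Finset.mem_coe, Finset.mem_Iio]
      by_contra hlt
      have hlt' : label N y ≤ σ.symm i := by simpa using hlt
      have := hσ _ _ hlt'
      rw [Equiv.apply_symm_apply] at this
      exact hi (γ.trans _ _ _ h this)
    have h2 : (label N x : ℕ) + 1 ≤ {i | γ.le i j}.ncard := by
      rw [← Fin.card_Iic, ← Set.ncard_coe_finset, ← Set.ncard_image_of_injective _ σ.injective]
      refine Set.ncard_le_ncard ?_
      rintro _ ⟨c, hc, rfl⟩
      exact hσ _ _ (by simpa using hc)
    have h1' : ({i | γ.Lt i j}.ncard : ℝ) ≤ label N y := by exact_mod_cast h1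
    have h2' : (label N x : ℝ) + 1 ≤ {i | γ.le i j}.ncard := by exact_mod_cast h2
    refine Same.symm ((same_iff_of_le (show (y : ℝ) ≤ x from hyx.le)).2 fun z hz => ?_)
    refine mem_iUnion.2 ⟨j, (div_lt_iff₀ hN).2 ?_, (lt_div_iff₀ hN).2 ?_⟩
    · exact h1'.trans_lt (hyl.trans_le (mul_le_mul_of_nonneg_right hz.1 hN.le))
    · exact (mul_le_mul_of_nonneg_right hz.2 hN.le).trans_lt (hxl.trans_le h2')

lemma measurable_comap_apply {ι κ α : Type*} [MeasurableSpace α] [MeasurableSpace ι] [Countable ι]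
    [MeasurableSingletonClass ι] {f : α → κ → ι} (hf : ∀ k, Measurable fun x => f x k)
    {g : α → BlockComposition ι} (hg : Measurable g) :
    Measurable fun x => (g x).comap (f x) := by
  refine measurable_iff.2 fun i j => ?_
  have : {x | ((g x).comap (f x)).le i j} = ⋃ a, ⋃ b, {x | f x i = a} ∩ {x | f x j = b} ∩
      {x | (g x).le a b} := by
    ext x
    simp only [mem_iUnion, mem_inter_iff, mem_ofPred_eq]
    constructor
    · intro h
      exact ⟨f x i, f x j, ⟨rfl, rfl⟩, h⟩
    · rintro ⟨a, b, ⟨rfl, rfl⟩, h⟩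
      exact h
  rw [this]
  refine MeasurableSet.iUnion fun a => MeasurableSet.iUnion fun b => ?_
  exact ((hf i (measurableSet_singleton a)).inter (hf j (measurableSet_singleton b))).inter
    (hg (measurableSet_setOf_le a b))

/-- Painting with the open set of `γ` is sampling its labels uniformly with replacement. The sorting
permutation disappears because a uniform label is invariant in law under it. -/
lemma paintLaw_toOpenSub {N k : ℕ} (γ : BlockComposition (Fin (N + 1)))
    (B : Set (BlockComposition (Fin k))) :
    γ.toOpenSub.paintLaw (restr k ⁻¹' B) =
      unif {X | γ.comap (fun i : Fin k => label N (X i)) ∈ B} := by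
  obtain ⟨σ, hσ⟩ := γ.exists_sort
  have hN : ((N + 1 : ℕ) : ℝ) ≠ 0 := by positivity
  let S : Set (ℕ → Fin (N + 1)) := {f | γ.comap (fun i : Fin k => f i) ∈ B}
  have hS : MeasurableSet S :=
    measurable_comap_apply (f := fun (f : ℕ → Fin (N + 1)) (i : Fin k) => f i)
      (fun i => measurable_pi_apply _) measurable_const (MeasurableSet.of_discrete (s := B))
  change _ = unif {X | (fun i => label N (X i)) ∈ S}
  rw [← unif_label_perm N σ S hS, paintLaw_apply _ (measurableSet_restr_preimage B)]
  have hc : {x : ℝ | x * (N + 1 : ℕ) ∈ range ((↑) : ℕ → ℝ)}.Countable :=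
    (countable_range _).preimage (mul_left_injective₀ hN)
  refine measure_congr ?_
  filter_upwards [ae_notMem_of_countable hc] with X hX
  have : (γ.toOpenSub.paint X).restr k = γ.comap (fun i : Fin k => σ (label N (X i))) := by
    ext i j
    exact paint_toOpenSub_le_iff hσ (hX i) (hX j)
  exact congrArg (· ∈ B) this

/-! ### Exchangeable finite measures -/

lemma exists_finite_perm {k : ℕ} {g : ℕ → ℕ} (hg : InjOn g (Iio k)) :
    ∃ σ : Equiv.Perm ℕ, {i | σ i ≠ i}.Finite ∧ ∀ i < k, σ i = g i := by
  induction k with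
  | zero => exact ⟨1, by simp, by simp⟩
  | succ k ih =>
    obtain ⟨σ, hσ, h⟩ := ih (hg.mono (Iio_subset_Iio (by omega)))
    -- The transposition corrects the value at `k`; the earlier values `g i` differ from both `σ k`
    -- and `g k`, so they stay.
    refine ⟨Equiv.swap (σ k) (g k) * σ, ?_, ?_⟩
    · refine (hσ.union (Finite.preimage σ.injective.injOn
        (Set.toFinite {σ k, g k}))).subset fun i hi => ?_
      by_contra h'
      simp only [mem_union, mem_ofPred_eq, mem_preimage, mem_insert_iff, mem_singleton_iff,
        not_or, not_not] at h'
      exact hi (by rw [Equiv.Perm.mul_apply, Equiv.swap_apply_of_ne_of_ne h'.2.1 h'.2.2, h'.1])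
    · intro i hi
      rcases Nat.lt_succ_iff_lt_or_eq.1 hi with hik | rfl
      · rw [Equiv.Perm.mul_apply, Equiv.swap_apply_of_ne_of_ne, h i hik]
        · exact fun he => hik.ne (σ.injective he)
        · rw [h i hik]
          exact fun he => hik.ne (hg (mem_Iio.2 hi) (mem_Iio.2 (Nat.lt_succ_self k)) he)
      · simp

lemma Exchangeable.measure_comap {m : Measure (BlockComposition ℕ)} (hm : Exchangeable m) {k : ℕ}
    {g : ℕ → ℕ} (hg : InjOn g (Iio k)) (B : Set (BlockComposition (Fin k))) :
    m {γ | γ.comap (fun i : Fin k => g i) ∈ B} = m (restr k ⁻¹' B) := by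
  obtain ⟨σ, hσ, h⟩ := exists_finite_perm hg
  have hσ' : {i | σ.symm i ≠ i}.Finite := by
    refine hσ.subset fun i hi h' => hi ?_
    rw [Equiv.symm_apply_eq]
    exact h'.symm
  rw [← (hm σ.symm hσ').measure_preimage (measurableSet_restr_preimage B).nullMeasurableSet]
  congr 1
  ext γ
  have : (γ.permute σ.symm).restr k = γ.comap (fun i : Fin k => g i) := by
    ext i j
    change γ.le (σ i) (σ j) ↔ γ.le (g i) (g j)
    rw [h i i.2, h j j.2]
  simp only [mem_preimage, this, mem_ofPred_eq]

lemma exchangeable_restrict {m : Measure (BlockComposition ℕ)} (hm : Exchangeable m)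
    {F : Set OpenSub} (hF : MeasurableSet F) : Exchangeable (m.restrict (asymp ⁻¹' F)) := by
  intro σ hσ
  have := (hm σ hσ).restrict_preimage (measurable_asymp hF)
  have h2 : permute σ ⁻¹' (asymp ⁻¹' F) = asymp ⁻¹' F := by
    ext γ
    simp only [mem_preimage, asymp_permute hσ]
  rwa [h2] at this

lemma ae_injective_unif : ∀ᵐ X ∂unif, Function.Injective X := by
  have : ∀ᵐ X ∂unif, ∀ i j : ℕ, i ≠ j → X i ≠ X j := by
    refine ae_all_iff.2 fun i => ae_all_iff.2 fun j => ?_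
    by_cases hij : i = j
    · exact .of_forall fun X h => absurd hij h
    have hS : MeasurableSet {p : unitInterval × unitInterval | p.1 = p.2} :=
      measurableSet_eq_fun measurable_fst measurable_snd
    have h0 : (volume.prod volume) {p : unitInterval × unitInterval | p.1 = p.2} = 0 := by
      rw [Measure.prod_apply hS]
      have : ∀ x : unitInterval, Prod.mk x ⁻¹' {p : unitInterval × unitInterval | p.1 = p.2} = {x} :=
        fun x => by ext y; simp [eq_comm]
      simp [this]
    rw [← Measure.infinitePi_map_eval_prod (P := fun _ : ℕ => (volume : Measure unitInterval)) hij,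
      Measure.map_apply (by fun_prop) hS] at h0
    filter_upwards [measure_eq_zero_iff_ae_notMem.1 h0] with X hX _ h
    exact hX h
  filter_upwards [this] with X hX i j h
  by_contra hij
  exact hX i j hij h

lemma eventually_label_ne {x y : unitInterval} (h : x ≠ y) :
    ∀ᶠ N in atTop, label N x ≠ label N y := by
  have hxy : 0 < |(x : ℝ) - y| := abs_pos.2 (sub_ne_zero.2 fun h' => h (Subtype.ext h'))
  obtain ⟨M, hM⟩ := exists_nat_gt (1 / |(x : ℝ) - y|)
  filter_upwards [eventually_ge_atTop M] with N hN he
  have h1 := label_le N x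
  have h2 := le_label_add_one N x
  have h3 := label_le N y
  have h4 := le_label_add_one N y
  rw [he] at h1 h2
  have hN' : (M : ℝ) ≤ (N + 1 : ℕ) := by exact_mod_cast hN.trans (Nat.le_succ N)
  have h5 : 1 < |(x : ℝ) - y| * (N + 1 : ℕ) := by
    rw [div_lt_iff₀ hxy] at hM
    nlinarith
  have h6 : |(x : ℝ) - y| * (N + 1 : ℕ) =
      |(x : ℝ) * (N + 1 : ℕ) - y * (N + 1 : ℕ)| := by
    rw [← sub_mul, abs_mul, abs_of_pos (show (0 : ℝ) < (N + 1 : ℕ) by positivity)]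
  rw [h6] at h5
  exact absurd h5 (not_lt.2 (abs_le.2 ⟨by linarith, by linarith⟩))

/-- Fubini puts the sample `X` outside. For injective `X` the first `k` sampled labels are distinct
once `N` is large, and exchangeability then gives exactly the mass of the cylinder. -/
lemma tendsto_lintegral_paintLaw {m : Measure (BlockComposition ℕ)} [IsFiniteMeasure m]
    (hm : Exchangeable m) {k : ℕ} (B : Set (BlockComposition (Fin k))) :
    Tendsto (fun N : ℕ => ∫⁻ γ, (γ.restr (N + 1)).toOpenSub.paintLaw (restr k ⁻¹' B) ∂m) atTop
      (𝓝 (m (restr k ⁻¹' B))) := by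
  let g : ℕ → BlockComposition ℕ × (ℕ → unitInterval) → BlockComposition (Fin k) := fun N p =>
    p.1.comap fun i : Fin k => (label N (p.2 i) : ℕ)
  have hg : ∀ N, Measurable (g N) := fun N =>
    measurable_comap_apply
      (f := fun (p : BlockComposition ℕ × (ℕ → unitInterval)) (i : Fin k) => (label N (p.2 i) : ℕ))
      (fun i => Measurable.comp (g := fun a : Fin (N + 1) => (a : ℕ)) .of_discrete
        ((measurable_label N).comp ((measurable_pi_apply (i : ℕ)).comp measurable_snd)))
      measurable_fst
  have hT : ∀ N, MeasurableSet (g N ⁻¹' B) := fun N => hg N .of_discrete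
  have heq : ∀ N, ∫⁻ γ, (γ.restr (N + 1)).toOpenSub.paintLaw (restr k ⁻¹' B) ∂m =
      ∫⁻ X, m ((fun γ => (γ, X)) ⁻¹' (g N ⁻¹' B)) ∂unif := by
    intro N
    rw [← Measure.prod_apply_symm (hT N), Measure.prod_apply (hT N)]
    refine lintegral_congr fun γ => ?_
    rw [paintLaw_toOpenSub]
    rfl
  simp only [heq]
  have hlim : m (restr k ⁻¹' B) = ∫⁻ _, m (restr k ⁻¹' B) ∂unif := by simp
  rw [hlim]
  refine tendsto_lintegral_of_dominated_convergence (fun _ => m univ)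
    (fun N => measurable_measure_prodMk_right (hT N))
    (fun N => .of_forall fun X => measure_mono (subset_univ _)) (by simp) ?_
  filter_upwards [ae_injective_unif] with X hX
  refine tendsto_const_nhds.congr' ?_
  have h1 : ∀ᶠ N in atTop, ∀ i j : Fin k, i ≠ j → label N (X i) ≠ label N (X j) := by
    refine eventually_all.2 fun i => eventually_all.2 fun j => ?_
    by_cases hij : i = j
    · exact .of_forall fun N h => absurd hij h
    · filter_upwards [eventually_label_ne fun h => hij (Fin.ext (hX h))] with N hN _
      exact hN
  filter_upwards [h1] with N hN
  refine (hm.measure_comap (g := fun i => (label N (X i) : ℕ)) ?_ B).symm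
  intro i hi j hj hij
  by_contra hne
  exact hN ⟨i, hi⟩ ⟨j, hj⟩ (fun h => hne (congrArg Fin.val h)) (Fin.ext hij)

/-- Gnedin's representation: `η` is a weak limit point of the laws of the open sets of `γ_[N+1]`,
which share one total mass on a compact space. -/
theorem exists_eq_paintMeasure {m : Measure (BlockComposition ℕ)} [IsFiniteMeasure m]
    (hm : Exchangeable m) : ∃ η : Measure OpenSub, IsFiniteMeasure η ∧ m = paintMeasure η := by
  let f : ℕ → BlockComposition ℕ → OpenSub := fun N γ => (γ.restr (N + 1)).toOpenSub
  have hf : ∀ N, Measurable (f N) := fun N => measurable_toOpenSub_restr (N + 1)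
  let η' : ℕ → FiniteMeasure OpenSub := fun N => ⟨m.map (f N), inferInstance⟩
  let M : ℝ≥0 := (m univ).toNNReal
  have hmass : ∀ N, (η' N).mass = M := fun N => by
    rw [← ENNReal.coe_inj, FiniteMeasure.ennreal_mass, ENNReal.coe_toNNReal (measure_ne_top _ _)]
    change m.map (f N) univ = _
    rw [Measure.map_apply (hf N) .univ, preimage_univ]
  -- A limit along a nonprincipal ultrafilter replaces a convergent subsequence.
  let F : Ultrafilter (FiniteMeasure OpenSub) := (hyperfilter ℕ).map η'
  obtain ⟨η, -, hη⟩ := (isCompact_setOfPred_finiteMeasure_eq_of_compactSpace OpenSub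
    M).ultrafilter_le_nhds F (le_principal_iff.2 (Filter.mem_map.2 (Filter.univ_mem' hmass)))
  have hη' : Tendsto η' (hyperfilter ℕ : Filter ℕ) (𝓝 η) := hη
  refine ⟨η, inferInstance, ?_⟩
  have hcyl : ∀ (k : ℕ) (B : Set (BlockComposition (Fin k))),
      m (restr k ⁻¹' B) = paintMeasure η (restr k ⁻¹' B) := by
    intro k B
    have hB := measurableSet_restr_preimage B
    unfold paintMeasure
    rw [Measure.bind_apply hB measurable_paintLaw.aemeasurable]
    have hle : ∀ U : OpenSub, U.paintLaw (restr k ⁻¹' B) ≠ ∞ := fun U => measure_ne_top _ _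
    have hcont : Continuous fun U : OpenSub => (U.paintLaw (restr k ⁻¹' B)).toNNReal :=
      continuous_iff_continuousAt.2 fun U =>
        (ENNReal.tendsto_toNNReal (hle U)).comp (continuous_paintLaw_apply B).continuousAt
    have h1 := FiniteMeasure.tendsto_iff_forall_lintegral_tendsto.1 hη'
      (BoundedContinuousFunction.mkOfCompact ⟨_, hcont⟩)
    simp only [BoundedContinuousFunction.mkOfCompact_apply, ContinuousMap.coe_mk,
      ENNReal.coe_toNNReal (hle _)] at h1
    refine tendsto_nhds_unique ?_ h1
    refine ((tendsto_lintegral_paintLaw hm B).mono_left Nat.hyperfilter_le_atTop).congr fun N => ?_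
    exact (lintegral_map (continuous_paintLaw_apply B).measurable (hf N)).symm
  refine ext_of_generate_finite cylinders generateFrom_cylinders isPiSystem_cylinders ?_ ?_
  · rintro _ ⟨k, B, rfl⟩
    exact hcyl k B
  · simpa using hcyl 0 univ

lemma Exchangeable.ae_exists_hasAsympOpen {m : Measure (BlockComposition ℕ)} [IsFiniteMeasure m]
    (hm : Exchangeable m) : ∀ᵐ γ ∂m, ∃ U, γ.HasAsympOpen U := by
  obtain ⟨η, -, rfl⟩ := exists_eq_paintMeasure hm
  unfold paintMeasure
  rw [ae_iff]
  refine (Measure.bind_apply measurableSet_exists_hasAsympOpen.compl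
    measurable_paintLaw.aemeasurable).trans ?_
  refine (lintegral_congr fun U => ?_).trans lintegral_zero
  exact ae_iff.1 U.ae_exists_hasAsympOpen

/-- Under `P^U` one has `asymp = U` almost surely, so the mixing measure is the image of `m` under
`asymp`. Eliminating `η` gives a form that transfers to restrictions and shifts. -/
lemma Exchangeable.measure_eq_lintegral {m : Measure (BlockComposition ℕ)} [IsFiniteMeasure m]
    (hm : Exchangeable m) {S : Set (BlockComposition ℕ)} (hS : MeasurableSet S) :
    m S = ∫⁻ γ, γ.asymp.paintLaw S ∂m := by
  obtain ⟨η, -, rfl⟩ := exists_eq_paintMeasure hm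
  have hmeas : Measurable fun U : OpenSub => U.paintLaw S :=
    (Measure.measurable_coe hS).comp measurable_paintLaw
  unfold paintMeasure
  rw [Measure.bind_apply hS measurable_paintLaw.aemeasurable]
  refine Eq.trans ?_ (Measure.lintegral_bind measurable_paintLaw.aemeasurable
      (hmeas.comp measurable_asymp).aemeasurable).symm
  refine lintegral_congr fun U => ?_
  change _ = ∫⁻ γ, γ.asymp.paintLaw S ∂U.paintLaw
  have : ∫⁻ γ, γ.asymp.paintLaw S ∂U.paintLaw = ∫⁻ _, U.paintLaw S ∂U.paintLaw := by
    refine lintegral_congr_ae ?_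
    filter_upwards [U.ae_asymp_eq] with γ hγ
    rw [hγ]
  rw [this]
  simp

end BlockComposition

/-! ### Exchangeable measures that are finite away from the one-block composition -/

namespace BlockComposition

open OpenSub

/-- The permutation which fixes the labels less than `n` and acts as `σ` on the others. -/
def permAbove (n : ℕ) (σ : Equiv.Perm ℕ) : Equiv.Perm ℕ where
  toFun i := if i < n then i else σ (i - n) + n
  invFun i := if i < n then i else σ.symm (i - n) + n
  left_inv i := by
    by_cases h : i < n
    · simp [h]
    · simp [h]; omega
  right_inv i := by
    by_cases h : i < n
    · simp [h]
    · simp [h]; omega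

lemma permAbove_symm_of_lt {n i : ℕ} (σ : Equiv.Perm ℕ) (h : i < n) :
    (permAbove n σ).symm i = i := by
  simp [permAbove, h]

lemma permAbove_symm_add (n i : ℕ) (σ : Equiv.Perm ℕ) :
    (permAbove n σ).symm (i + n) = σ.symm i + n := by
  simp [permAbove]

lemma finite_support_permAbove {n : ℕ} {σ : Equiv.Perm ℕ} (hσ : {i | σ i ≠ i}.Finite) :
    {i | permAbove n σ i ≠ i}.Finite := by
  refine (hσ.image (· + n)).subset fun i hi => ?_
  have hi' : (if i < n then i else σ (i - n) + n) ≠ i := hi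
  split_ifs at hi' with h
  · exact absurd rfl hi'
  · exact ⟨i - n, fun h' => hi' (by rw [h']; omega), by simp; omega⟩

lemma permute_shift (n : ℕ) (σ : Equiv.Perm ℕ) (γ : BlockComposition ℕ) :
    (γ.shift n).permute σ = (γ.permute (permAbove n σ)).shift n := by
  ext i j
  change γ.le (σ.symm i + n) (σ.symm j + n) ↔
    γ.le ((permAbove n σ).symm (i + n)) ((permAbove n σ).symm (j + n))
  rw [permAbove_symm_add, permAbove_symm_add]

lemma permute_permAbove_preimage_nontriv (n : ℕ) (σ : Equiv.Perm ℕ) :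
    permute (permAbove n σ) ⁻¹' nontriv n = nontriv n := by
  ext γ
  have : (γ.permute (permAbove n σ)).restr n = γ.restr n := by
    ext i j
    change γ.le ((permAbove n σ).symm i) ((permAbove n σ).symm j) ↔ γ.le i j
    rw [permAbove_symm_of_lt σ i.2, permAbove_symm_of_lt σ j.2]
  simp only [nontriv, mem_preimage, mem_ofPred_eq, this]

/-- Restricting to `nontriv n` breaks the symmetry among the first `n` labels only, so dropping them
restores exchangeability. -/
lemma exchangeable_map_shift {μ : Measure (BlockComposition ℕ)} (hμ : Exchangeable μ) (n : ℕ) :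
    Exchangeable ((μ.restrict (nontriv n)).map (shift n)) := by
  intro σ hσ
  refine ⟨measurable_permute σ, ?_⟩
  have h := (hμ _ (finite_support_permAbove (n := n) hσ)).restrict_preimage
    (measurableSet_nontriv n)
  rw [permute_permAbove_preimage_nontriv] at h
  have hc : permute σ ∘ shift n = shift n ∘ permute (permAbove n σ) :=
    funext fun γ => permute_shift n σ γ
  rw [Measure.map_map (measurable_permute σ) (measurable_shift n), hc,
    ← Measure.map_map (measurable_shift n) (measurable_permute _), h.map_eq]

variable {μ : Measure (BlockComposition ℕ)}

lemma isFiniteMeasure_map_shift (hfin : ∀ n, μ (nontriv n) < ∞) (n : ℕ) :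
    IsFiniteMeasure ((μ.restrict (nontriv n)).map (shift n)) := by
  have : IsFiniteMeasure (μ.restrict (nontriv n)) := ⟨by simpa using hfin n⟩
  infer_instance

lemma ae_exists_nontriv (h1 : μ {one} = 0) : ∀ᵐ γ ∂μ, ∃ n, γ ∈ nontriv n := by
  filter_upwards [measure_eq_zero_iff_ae_notMem.1 h1] with γ hγ
  have : γ ∈ ⋃ n, nontriv n := by rw [iUnion_nontriv]; exact hγ
  exact mem_iUnion.1 this

lemma ae_exists_hasAsympOpen (hμ : Exchangeable μ) (h1 : μ {one} = 0)
    (hfin : ∀ n, μ (nontriv n) < ∞) : ∀ᵐ γ ∂μ, ∃ U, γ.HasAsympOpen U := by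
  have h : ∀ n, ∀ᵐ γ ∂μ, γ ∈ nontriv n → ∃ U, γ.HasAsympOpen U := fun n => by
    have := isFiniteMeasure_map_shift hfin n
    have h2 := ae_of_ae_map (measurable_shift n).aemeasurable
      (exchangeable_map_shift hμ n).ae_exists_hasAsympOpen
    filter_upwards [ae_imp_of_ae_restrict h2] with γ hγ hn
    obtain ⟨U, hU⟩ := hγ hn
    exact ⟨U, hasAsympOpen_shift.1 hU⟩
  filter_upwards [ae_exists_nontriv h1, ae_all_iff.2 h] with γ ⟨n, hn⟩ hγ
  exact hγ n hn

lemma measurable_paintLaw_asymp {S : Set (BlockComposition ℕ)} (hS : MeasurableSet S) :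
    Measurable fun γ : BlockComposition ℕ => γ.asymp.paintLaw S :=
  ((Measure.measurable_coe hS).comp measurable_paintLaw).comp measurable_asymp

/-- The finite disintegration applied to the shifted measure; `asymp` ignores the dropped labels. -/
lemma restrict_nontriv_shift (hμ : Exchangeable μ) (hfin : ∀ n, μ (nontriv n) < ∞)
    {F : Set OpenSub} (hF : MeasurableSet F) {S : Set (BlockComposition ℕ)} (hS : MeasurableSet S)
    (n : ℕ) : μ.restrict (asymp ⁻¹' F) (nontriv n ∩ shift n ⁻¹' S) =
      ∫⁻ γ in nontriv n, γ.asymp.paintLaw S ∂μ.restrict (asymp ⁻¹' F) := by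
  have hA : MeasurableSet (asymp ⁻¹' F) := measurable_asymp hF
  have hs : shift n ⁻¹' (asymp ⁻¹' F) = asymp ⁻¹' F := by
    ext γ
    simp only [mem_preimage, asymp_shift]
  have := isFiniteMeasure_map_shift hfin n
  have h := (exchangeable_restrict (exchangeable_map_shift hμ n) hF).measure_eq_lintegral hS
  rw [Measure.restrict_map (measurable_shift n) hA, hs, Measure.map_apply (measurable_shift n) hS,
    lintegral_map (measurable_paintLaw_asymp hS) (measurable_shift n)] at h
  simp only [asymp_shift] at h
  rw [Measure.restrict_restrict hA, inter_comm, ← Measure.restrict_restrict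
    (measurableSet_nontriv n), Measure.restrict_apply (measurable_shift n hS)] at h
  rw [inter_comm, h]

lemma restrict_shift_nontriv (hμ : Exchangeable μ) {F : Set OpenSub} (hF : MeasurableSet F) {k : ℕ}
    (B : Set (BlockComposition (Fin k))) (n : ℕ) :
    μ.restrict (asymp ⁻¹' F) (restr k ⁻¹' B ∩ shift k ⁻¹' nontriv n) =
      μ.restrict (asymp ⁻¹' F) (nontriv n ∩ shift n ⁻¹' (restr k ⁻¹' B)) := by
  let B' : Set (BlockComposition (Fin (n + k))) :=
    {δ | δ.comap (Fin.castAdd k) ≠ one ∧ δ.comap (Fin.natAdd n) ∈ B}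
  -- Reads the labels `k, …, k + n - 1` first and then `0, …, k - 1`, so the two groups trade
  -- places.
  let g : ℕ → ℕ := fun i => if i < n then i + k else i - n
  have hg : InjOn g (Iio (n + k)) := by
    intro i hi j hj hij
    simp only [mem_Iio] at hi hj
    simp only [g] at hij
    split_ifs at hij <;> omega
  have h := (exchangeable_restrict hμ hF).measure_comap hg B'
  have e1 : {γ : BlockComposition ℕ | γ.comap (fun i : Fin (n + k) => g i) ∈ B'} =
      restr k ⁻¹' B ∩ shift k ⁻¹' nontriv n := by
    ext γ
    have h1 : (γ.comap (fun i : Fin (n + k) => g i)).comap (Fin.castAdd k) =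
        (γ.shift k).restr n := by
      ext i j
      change γ.le (g i) (g j) ↔ γ.le (i + k) (j + k)
      simp [g]
    have h2 : (γ.comap (fun i : Fin (n + k) => g i)).comap (Fin.natAdd n) = γ.restr k := by
      ext i j
      change γ.le (g (n + i)) (g (n + j)) ↔ γ.le i j
      simp [g]
    simp only [B', mem_ofPred_eq, h1, h2, mem_inter_iff, mem_preimage, nontriv]
    exact and_comm
  have e2 : restr (n + k) ⁻¹' B' = nontriv n ∩ shift n ⁻¹' (restr k ⁻¹' B) := by
    ext γ
    have h2 : (γ.restr (n + k)).comap (Fin.natAdd n) = (γ.shift n).restr k := by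
      ext i j
      change γ.le (n + i : ℕ) (n + j : ℕ) ↔ γ.le (i + n) (j + n)
      rw [add_comm n, add_comm n]
    simp only [B', mem_preimage, mem_ofPred_eq, h2, mem_inter_iff]
    rfl
  rw [e1, e2] at h
  exact h

lemma _root_.OpenSub.paintLaw_singleton_one {U : OpenSub} (hU : U ≠ OpenSub.one) :
    U.paintLaw {BlockComposition.one} = 0 := by
  refine measure_mono_null ?_ (ae_iff.1 U.ae_asymp_eq)
  rintro _ rfl
  rw [mem_ofPred_eq, asymp_one]
  exact hU.symm

/-- The part of `μ` on which the asymptotic open set is not `]0,1[`. -/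
noncomputable def dislocation (μ : Measure (BlockComposition ℕ)) : Measure OpenSub :=
  (μ.restrict (asymp ⁻¹' {OpenSub.one}ᶜ)).map asymp

lemma paintMeasure_dislocation_apply {S : Set (BlockComposition ℕ)} (hS : MeasurableSet S) :
    paintMeasure (dislocation μ) S =
      ∫⁻ γ in asymp ⁻¹' {OpenSub.one}ᶜ, γ.asymp.paintLaw S ∂μ := by
  unfold paintMeasure dislocation
  rw [Measure.bind_apply hS measurable_paintLaw.aemeasurable]
  exact lintegral_map ((Measure.measurable_coe hS).comp measurable_paintLaw) measurable_asymp

/-- Nontriviality is tested on labels other than the first `k`, so that it does not bias `γ_[k]`; it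
is harmless in the limit because `U_γ ≠ ]0,1[` rules out a trivial tail. -/
theorem restrict_asymp_ne_one (hμ : Exchangeable μ) (h1 : μ {one} = 0)
    (hfin : ∀ n, μ (nontriv n) < ∞) :
    μ.restrict (asymp ⁻¹' {OpenSub.one}ᶜ) = paintMeasure (dislocation μ) := by
  have hF : MeasurableSet ({OpenSub.one}ᶜ : Set OpenSub) := (measurableSet_singleton _).compl
  have hA : MeasurableSet (asymp ⁻¹' {OpenSub.one}ᶜ) := measurable_asymp hF
  set ρ := μ.restrict (asymp ⁻¹' {OpenSub.one}ᶜ) with hρ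
  have hρ1 : ρ {one} = 0 := le_antisymm ((Measure.restrict_apply_le _ _).trans h1.le) zero_le
  refine measure_ext_cylinders hρ1 ?_
    (fun n => (Measure.restrict_apply_le _ _).trans_lt (hfin n)) ?_
  · rw [paintMeasure_dislocation_apply (measurableSet_singleton _)]
    refine (setLIntegral_congr_fun hA fun γ hγ => ?_).trans lintegral_zero
    exact paintLaw_singleton_one hγ
  rintro _ ⟨k, B, rfl⟩
  have hB : MeasurableSet (restr k ⁻¹' B) := measurableSet_restr_preimage B
  have hshift : (ρ.restrict (restr k ⁻¹' B)).map (shift k) {one} = 0 := by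
    rw [Measure.map_apply (measurable_shift k) (measurableSet_singleton _)]
    refine measure_mono_null ?_ (?_ : ρ.restrict (restr k ⁻¹' B) (asymp ⁻¹' {OpenSub.one}ᶜ)ᶜ = 0)
    · intro γ hγ h
      refine h ?_
      rw [mem_singleton_iff, ← asymp_shift k, show γ.shift k = one from hγ, asymp_one]
    · refine le_antisymm ((Measure.restrict_apply_le _ _).trans ?_) zero_le
      rw [hρ, Measure.restrict_apply hA.compl, compl_inter_self, measure_empty]
  have hdens : ρ.withDensity (fun γ => γ.asymp.paintLaw (restr k ⁻¹' B)) {one} = 0 :=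
    withDensity_absolutelyContinuous _ _ hρ1
  calc ρ (restr k ⁻¹' B) = (ρ.restrict (restr k ⁻¹' B)).map (shift k) univ := by
        rw [Measure.map_apply (measurable_shift k) .univ, preimage_univ,
          Measure.restrict_apply_univ]
    _ = ⨆ n, ρ (restr k ⁻¹' B ∩ shift k ⁻¹' nontriv n) := by
        rw [measure_eq_iSup_nontriv hshift]
        congr 1
        ext n
        rw [univ_inter, Measure.map_apply (measurable_shift k) (measurableSet_nontriv n),
          Measure.restrict_apply (measurable_shift k (measurableSet_nontriv n)), inter_comm]
    _ = ⨆ n, ρ.withDensity (fun γ => γ.asymp.paintLaw (restr k ⁻¹' B)) (univ ∩ nontriv n) := by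
        congr 1
        ext n
        rw [restrict_shift_nontriv hμ hF, restrict_nontriv_shift hμ hfin hF hB, univ_inter,
          withDensity_apply _ (measurableSet_nontriv n)]
    _ = paintMeasure (dislocation μ) (restr k ⁻¹' B) := by
        rw [← measure_eq_iSup_nontriv hdens, withDensity_apply _ .univ, Measure.restrict_univ,
          paintMeasure_dislocation_apply hB]

/-! ### Integrability of `1 - s₁` -/

lemma setOf_not_sim_subset (i j : ℕ) :
    {γ : BlockComposition ℕ | ¬ γ.Sim i j} ⊆ nontriv (max i j + 1) := by
  intro γ hγ h
  have h1 : (γ.restr (max i j + 1)).le ⟨i, by omega⟩ ⟨j, by omega⟩ := by rw [h]; trivial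
  have h2 : (γ.restr (max i j + 1)).le ⟨j, by omega⟩ ⟨i, by omega⟩ := by rw [h]; trivial
  exact hγ ⟨h1, h2⟩

lemma lintegral_one_sub_s1_dislocation_le (hμ : Exchangeable μ) (h1 : μ {one} = 0)
    (hfin : ∀ n, μ (nontriv n) < ∞) :
    ∫⁻ U, (1 - U.s1) ∂(dislocation μ) ≤ μ (nontriv 2) := by
  have hS : MeasurableSet {γ : BlockComposition ℕ | ¬ γ.Sim 0 1} := (measurableSet_sim 0 1).compl
  calc ∫⁻ U, (1 - U.s1) ∂(dislocation μ)
      ≤ ∫⁻ U, U.paintLaw {γ | ¬ γ.Sim 0 1} ∂(dislocation μ) :=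
        lintegral_mono fun U => U.one_sub_s1_le
    _ = paintMeasure (dislocation μ) {γ | ¬ γ.Sim 0 1} :=
        (Measure.bind_apply hS measurable_paintLaw.aemeasurable).symm
    _ ≤ μ {γ | ¬ γ.Sim 0 1} := by
        rw [← restrict_asymp_ne_one hμ h1 hfin]
        exact Measure.restrict_apply_le _ _
    _ ≤ μ (nontriv 2) := measure_mono (setOf_not_sim_subset 0 1)

theorem isDislocationMeasure_dislocation (hμ : Exchangeable μ) (h1 : μ {one} = 0)
    (hfin : ∀ n, μ (nontriv n) < ∞) : IsDislocationMeasure (dislocation μ) where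
  one_eq_zero := by
    unfold dislocation
    rw [Measure.map_apply measurable_asymp (measurableSet_singleton _),
      Measure.restrict_apply (measurable_asymp (measurableSet_singleton _)), ← preimage_inter,
      inter_compl_self, preimage_empty, measure_empty]
  lintegral_lt_top := (lintegral_one_sub_s1_dislocation_le hμ h1 hfin).trans_lt (hfin 2)

/-! ### Erosion -/

lemma _root_.OpenSub.paintLaw_one_compl : OpenSub.one.paintLaw {BlockComposition.one}ᶜ = 0 := by
  rw [paintLaw_apply _ (measurableSet_singleton _).compl]
  refine measure_eq_zero_iff_ae_notMem.2 ?_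
  filter_upwards [ae_notMem_of_countable (S := {0, 1}) (by simp)] with X hX
  simp only [mem_preimage, mem_compl_iff, mem_singleton_iff, not_not]
  have hmem : ∀ i, (X i : ℝ) ∈ Ioo (0 : ℝ) 1 := fun i => by
    have := hX i
    simp only [mem_insert_iff, mem_singleton_iff, not_or] at this
    exact ⟨lt_of_le_of_ne (X i).2.1 (Ne.symm this.1), lt_of_le_of_ne (X i).2.2 this.2⟩
  ext i j
  refine iff_of_true ?_ trivial
  rcases le_total (X i) (X j) with h | h
  · exact Or.inl h
  · refine Or.inr (Same.symm ((same_iff_of_le (show (X j : ℝ) ≤ X i from h)).2 ?_))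
    exact Icc_subset_Ioo (hmem j).1 (hmem i).2

/-- The law painted from `]0,1[` is the point mass at `one`, so the disintegration on `nontriv n`
puts all labels from `n` on in one block. -/
lemma ae_shift_eq_one (hμ : Exchangeable μ) (h1 : μ {one} = 0) (hfin : ∀ n, μ (nontriv n) < ∞) :
    ∀ᵐ γ ∂μ, γ.asymp = OpenSub.one → ∃ n, γ.shift n = one := by
  have hS : MeasurableSet ({one}ᶜ : Set (BlockComposition ℕ)) := (measurableSet_singleton _).compl
  have hF : MeasurableSet ({OpenSub.one} : Set OpenSub) := measurableSet_singleton _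
  have h : ∀ n, ∀ᵐ γ ∂μ, γ.asymp = OpenSub.one → γ ∈ nontriv n → γ.shift n = one := fun n => by
    have h2 := restrict_nontriv_shift hμ hfin hF hS n
    have h3 : ∫⁻ γ in nontriv n, γ.asymp.paintLaw {one}ᶜ ∂μ.restrict (asymp ⁻¹' {OpenSub.one}) =
        0 := by
      rw [Measure.restrict_restrict (measurableSet_nontriv n)]
      refine (setLIntegral_congr_fun ((measurableSet_nontriv n).inter (measurable_asymp hF))
        fun γ hγ => ?_).trans lintegral_zero
      simp only [show γ.asymp = OpenSub.one from hγ.2, paintLaw_one_compl]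
    rw [h3] at h2
    filter_upwards [ae_imp_of_ae_restrict (measure_eq_zero_iff_ae_notMem.1 h2)] with γ hγ ha hn
    by_contra hne
    exact hγ ha ⟨hn, hne⟩
  filter_upwards [ae_exists_nontriv h1, ae_all_iff.2 h] with γ ⟨n, hn⟩ hγ ha
  exact ⟨n, hγ n ha hn⟩

/-- The compositions having a block with complement `S`. -/
def coblock (S : Finset ℕ) : Set (BlockComposition ℕ) :=
  {γ | (∀ i ∉ S, ∀ j ∉ S, γ.le i j) ∧ ∀ i ∈ S, ∀ j ∉ S, ¬ γ.Sim i j}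

lemma measurableSet_coblock (S : Finset ℕ) : MeasurableSet (coblock S) := by
  have : coblock S = (⋂ i, ⋂ (_ : i ∉ S), ⋂ j, ⋂ (_ : j ∉ S), {γ | γ.le i j}) ∩
      ⋂ i, ⋂ (_ : i ∈ S), ⋂ j, ⋂ (_ : j ∉ S), {γ | γ.Sim i j}ᶜ := by
    ext γ
    simp [coblock]
  rw [this]
  refine MeasurableSet.inter ?_ ?_ <;>
    refine MeasurableSet.iInter fun i => MeasurableSet.iInter fun _ => MeasurableSet.iInter fun j =>
      MeasurableSet.iInter fun _ => ?_
  · exact measurableSet_setOf_le i j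
  · exact (measurableSet_sim i j).compl

lemma exists_mem_coblock {γ : BlockComposition ℕ} {n : ℕ} (h : γ.shift n = one) :
    ∃ S, γ ∈ coblock S := by
  classical
  have hle : ∀ i j, n ≤ i → n ≤ j → γ.le i j := by
    intro i j hi hj
    have h1 : (γ.shift n).le (i - n) (j - n) := by rw [h]; trivial
    have h2 : γ.le (i - n + n) (j - n + n) := h1
    rwa [Nat.sub_add_cancel hi, Nat.sub_add_cancel hj] at h2
  refine ⟨(Finset.range n).filter fun i => ¬ γ.Sim i n, ?_⟩
  have hS : ∀ i, i ∉ (Finset.range n).filter (fun i => ¬ γ.Sim i n) → γ.Sim i n := by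
    intro i hi
    simp only [Finset.mem_filter, Finset.mem_range, not_and, not_not] at hi
    by_cases hin : i < n
    · exact hi hin
    · exact ⟨hle _ _ (by omega) le_rfl, hle _ _ le_rfl (by omega)⟩
  refine ⟨fun i hi j hj => γ.trans _ _ _ (hS i hi).1 (hS j hj).2, fun i hi j hj hij => ?_⟩
  have h1 := hS j hj
  exact (Finset.mem_filter.1 hi).2 ⟨γ.trans _ _ _ hij.1 h1.1, γ.trans _ _ _ h1.2 hij.2⟩

/-- Two cofinite blocks share a label, hence coincide. -/
lemma coblock_inj {γ : BlockComposition ℕ} {S S' : Finset ℕ} (h : γ ∈ coblock S)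
    (h' : γ ∈ coblock S') : S = S' := by
  have key : ∀ {S S' : Finset ℕ}, γ ∈ coblock S → γ ∈ coblock S' → S ⊆ S' := by
    intro S S' h h' i hi
    by_contra hi'
    obtain ⟨j, hj⟩ := Infinite.exists_notMem_finset (S ∪ S')
    rw [Finset.mem_union, not_or] at hj
    exact h.2 i hi j hj.1 ⟨h'.1 i hi' j hj.2, h'.1 j hj.2 i hi'⟩
  exact (key h h').antisymm (key h' h)

lemma permute_preimage_coblock (σ : Equiv.Perm ℕ) (S : Finset ℕ) :
    permute σ ⁻¹' coblock S = coblock (S.map σ.symm.toEmbedding) := by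
  have hmem : ∀ i, i ∈ S.map σ.symm.toEmbedding ↔ σ i ∈ S := by
    intro i
    simp
  ext γ
  constructor
  · rintro ⟨h, h'⟩
    refine ⟨fun i hi j hj => ?_, fun i hi j hj => ?_⟩
    · have := h (σ i) (by rwa [hmem] at hi) (σ j) (by rwa [hmem] at hj)
      simpa [permute, comap] using this
    · have := h' (σ i) (by rwa [hmem] at hi) (σ j) (by rwa [hmem] at hj)
      simpa [permute, comap, Sim] using this
  · rintro ⟨h, h'⟩
    refine ⟨fun i hi j hj => ?_, fun i hi j hj => ?_⟩
    · exact h (σ.symm i) (by rw [hmem]; simpa) (σ.symm j) (by rw [hmem]; simpa)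
    · exact h' (σ.symm i) (by rw [hmem]; simpa) (σ.symm j) (by rw [hmem]; simpa)

lemma finite_support_swap (a b : ℕ) : {i | Equiv.swap a b i ≠ i}.Finite := by
  refine (Set.toFinite {a, b}).subset fun i hi => ?_
  by_contra h
  simp only [mem_insert_iff, mem_singleton_iff, not_or] at h
  exact hi (Equiv.swap_apply_of_ne_of_ne h.1 h.2)

/-- Replacing `b` by any `l ∉ S` gives infinitely many disjoint events of the same mass. In all of
them `a` stays outside the cofinite block while `b` joins it, so their union separates `a` from `b`
and has finite mass. -/
lemma measure_coblock_eq_zero (hμ : Exchangeable μ) (hfin : ∀ n, μ (nontriv n) < ∞)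
    {S : Finset ℕ} {a b : ℕ} (ha : a ∈ S) (hb : b ∈ S) (hab : a ≠ b) : μ (coblock S) = 0 := by
  let S' : {l : ℕ // l ∉ S} → Finset ℕ := fun l => S.map (Equiv.swap b l).symm.toEmbedding
  have hmem : ∀ l i, i ∈ S' l ↔ Equiv.swap b l i ∈ S := by
    intro l i
    simp [S']
  have hinj : Function.Injective S' := by
    intro l l' hll
    by_contra hne
    have h1 : (l : ℕ) ∈ S' l := by rw [hmem]; simpa
    rw [hll, hmem, Equiv.swap_apply_of_ne_of_ne (fun h => l.2 (by rw [h]; exact hb))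
      (fun h => hne (Subtype.ext h))] at h1
    exact l.2 h1
  have hμS : ∀ l, μ (coblock (S' l)) = μ (coblock S) := by
    intro l
    rw [← permute_preimage_coblock]
    exact (hμ _ (finite_support_swap b l)).measure_preimage
      (measurableSet_coblock S).nullMeasurableSet
  have hsub : ⋃ l, coblock (S' l) ⊆ nontriv (max a b + 1) := by
    refine iUnion_subset fun l γ hγ => setOf_not_sim_subset a b (hγ.2 a ?_ b ?_)
    · rw [hmem, Equiv.swap_apply_of_ne_of_ne hab (fun h => l.2 (by rw [← h]; exact ha))]
      exact ha
    · rw [hmem, Equiv.swap_apply_left]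
      exact l.2
  have hsum : ∑' _ : {l : ℕ // l ∉ S}, μ (coblock S) = μ (⋃ l, coblock (S' l)) := by
    rw [measure_iUnion _ fun l => measurableSet_coblock _]
    · simp only [hμS]
    · intro l l' hne
      refine disjoint_left.2 fun γ h h' => hne (hinj (coblock_inj h h'))
  by_contra hne
  have : Infinite {l : ℕ // l ∉ S} := S.finite_toSet.infinite_compl.to_subtype
  rw [ENNReal.tsum_const_eq_top_of_ne_zero hne] at hsum
  exact absurd ((measure_mono hsub).trans_lt (hfin _)) (by rw [← hsum]; exact lt_irrefl _)

lemma coblock_empty : coblock ∅ = {one} := by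
  ext γ
  simp only [coblock, Finset.notMem_empty, not_false_eq_true, forall_const, IsEmpty.forall_iff,
    and_true, mem_ofPred_eq, mem_singleton_iff]
  constructor
  · intro h
    ext i j
    exact iff_of_true (h i j) trivial
  · rintro rfl i j
    trivial

lemma eq_eps_of_mem_coblock {γ : BlockComposition ℕ} {i : ℕ} (h : γ ∈ coblock {i}) :
    γ = epsLeft i ∨ γ = epsRight i := by
  obtain ⟨h1, h2⟩ := h
  simp only [Finset.mem_singleton] at h1 h2
  have h2' := h2 i rfl
  -- `i + 1` serves as a representative of the cofinite block; its position relative to `i` decides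
  -- between the two cases.
  have hi : i + 1 ≠ i := by omega
  by_cases hle : γ.le i (i + 1)
  · left
    have hl : ∀ j, j ≠ i → γ.le i j := fun j hj => γ.trans _ _ _ hle (h1 _ hi j hj)
    ext a b
    change γ.le a b ↔ a = i ∨ b ≠ i
    by_cases ha : a = i
    · subst ha
      refine iff_of_true ?_ (Or.inl rfl)
      by_cases hb : b = a
      · rw [hb]; exact γ.le_refl a
      · exact hl b hb
    · by_cases hb : b = i
      · subst hb
        exact iff_of_false (fun h => h2' a ha ⟨hl a ha, h⟩) (by simp [ha])
      · exact iff_of_true (h1 a ha b hb) (Or.inr hb)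
  · right
    have hl : ∀ j, j ≠ i → γ.le j i := fun j hj =>
      γ.trans _ _ _ (h1 j hj _ hi) ((γ.total _ _).resolve_left hle)
    ext a b
    change γ.le a b ↔ a ≠ i ∨ b = i
    by_cases ha : a = i
    · subst ha
      by_cases hb : b = a
      · rw [hb]; exact iff_of_true (γ.le_refl a) (Or.inr rfl)
      · exact iff_of_false (fun h => h2' b hb ⟨h, hl b hb⟩) (by simp [hb])
    · refine iff_of_true ?_ (Or.inl ha)
      by_cases hb : b = i
      · rw [hb]; exact hl a ha
      · exact h1 a ha b hb

lemma ae_eq_eps (hμ : Exchangeable μ) (h1 : μ {one} = 0) (hfin : ∀ n, μ (nontriv n) < ∞) :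
    ∀ᵐ γ ∂μ, γ.asymp = OpenSub.one → γ ∈ range epsLeft ∪ range epsRight := by
  have h : ∀ᵐ γ ∂μ, ∀ S : Finset ℕ, 1 < S.card → γ ∉ coblock S := by
    refine ae_all_iff.2 fun S => ?_
    by_cases hS : 1 < S.card
    · obtain ⟨a, ha, b, hb, hab⟩ := Finset.one_lt_card.1 hS
      filter_upwards [measure_eq_zero_iff_ae_notMem.1
        (measure_coblock_eq_zero hμ hfin ha hb hab)] with γ hγ _
      exact hγ
    · exact .of_forall fun γ h => absurd h hS
  filter_upwards [h, ae_shift_eq_one hμ h1 hfin, measure_eq_zero_iff_ae_notMem.1 h1] with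
    γ hγ hs hne ha
  obtain ⟨n, hn⟩ := hs ha
  obtain ⟨S, hS⟩ := exists_mem_coblock hn
  have hc : S.card = 1 := by
    have h2 : ¬ 1 < S.card := fun h => hγ S h hS
    have h3 : S.card ≠ 0 := by
      intro h
      rw [Finset.card_eq_zero.1 h, coblock_empty] at hS
      exact hne hS
    omega
  obtain ⟨i, rfl⟩ := Finset.card_eq_one.1 hc
  rcases eq_eps_of_mem_coblock hS with rfl | rfl
  · exact Or.inl ⟨i, rfl⟩
  · exact Or.inr ⟨i, rfl⟩

lemma hasAsympOpen_epsLeft (i : ℕ) : (epsLeft i).HasAsympOpen OpenSub.one := by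
  rw [← hasAsympOpen_shift (n := i + 1)]
  have : (epsLeft i).shift (i + 1) = one := by
    ext a b
    exact iff_of_true (Or.inr (show b + (i + 1) ≠ i by omega)) trivial
  rw [this]
  exact hasAsympOpen_one

lemma hasAsympOpen_epsRight (i : ℕ) : (epsRight i).HasAsympOpen OpenSub.one := by
  rw [← hasAsympOpen_shift (n := i + 1)]
  have : (epsRight i).shift (i + 1) = one := by
    ext a b
    exact iff_of_true (Or.inl (show a + (i + 1) ≠ i by omega)) trivial
  rw [this]
  exact hasAsympOpen_one

lemma injective_epsLeft : Function.Injective epsLeft := by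
  intro i j h
  by_contra hij
  have h1 : (epsLeft j).le (i + j + 1) i := Or.inr hij
  rw [← h] at h1
  rcases h1 with h1 | h1
  · omega
  · exact h1 rfl

lemma injective_epsRight : Function.Injective epsRight := by
  intro i j h
  by_contra hij
  have h1 : (epsRight j).le i (i + j + 1) := Or.inl hij
  rw [← h] at h1
  rcases h1 with h1 | h1
  · exact h1 rfl
  · omega

lemma epsLeft_ne_epsRight (i j : ℕ) : epsLeft i ≠ epsRight j := by
  intro h
  have h1 : (epsLeft i).le i (i + j + 1) := Or.inl rfl
  rw [h] at h1
  have hij : i ≠ j := h1.resolve_right (by omega)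
  have h2 : (epsRight j).le (i + j + 1) i := Or.inl (by omega)
  rw [← h] at h2
  rcases h2 with h2 | h2
  · omega
  · exact h2 rfl

lemma permute_epsLeft (σ : Equiv.Perm ℕ) (i : ℕ) : (epsLeft i).permute σ = epsLeft (σ i) := by
  ext a b
  change σ.symm a = i ∨ σ.symm b ≠ i ↔ a = σ i ∨ b ≠ σ i
  rw [Equiv.symm_apply_eq, Ne, Equiv.symm_apply_eq]

lemma permute_epsRight (σ : Equiv.Perm ℕ) (i : ℕ) : (epsRight i).permute σ = epsRight (σ i) := by
  ext a b
  change σ.symm a ≠ i ∨ σ.symm b = i ↔ a ≠ σ i ∨ b = σ i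
  rw [Ne, Equiv.symm_apply_eq, Equiv.symm_apply_eq]

lemma injective_permute (σ : Equiv.Perm ℕ) : Function.Injective (permute σ) := by
  intro γ γ' h
  ext i j
  have h1 : (γ.permute σ).le (σ i) (σ j) ↔ (γ'.permute σ).le (σ i) (σ j) := by rw [h]
  simpa [permute, comap] using h1

lemma Exchangeable.measure_permute_singleton (hμ : Exchangeable μ) {σ : Equiv.Perm ℕ}
    (hσ : {i | σ i ≠ i}.Finite) (γ : BlockComposition ℕ) : μ {γ.permute σ} = μ {γ} := by
  rw [← (hμ σ hσ).measure_preimage (measurableSet_singleton _).nullMeasurableSet,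
    ← image_singleton, (injective_permute σ).preimage_image]

lemma restrict_range_eq {f : ℕ → BlockComposition ℕ} (hf : Function.Injective f) {c : ℝ≥0}
    (hc : ∀ i, μ {f i} = c) :
    μ.restrict (range f) = c • Measure.sum fun i => Measure.dirac (f i) := by
  rw [← iUnion_singleton_eq_range, Measure.restrict_iUnion _ fun i => measurableSet_singleton _]
  · ext S hS
    simp only [Measure.restrict_singleton, hc, Measure.sum_apply _ hS, Measure.smul_apply,
      smul_eq_mul, ENNReal.tsum_mul_left]
    rfl
  · intro i j hij
    simpa using fun h => hij (hf h)

lemma epsLeft_zero_subset : {epsLeft 0} ⊆ nontriv 2 := by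
  refine subset_trans ?_ (setOf_not_sim_subset 0 1)
  rintro _ rfl h
  rcases h.2 with h | h <;> omega

lemma epsRight_zero_subset : {epsRight 0} ⊆ nontriv 2 := by
  refine subset_trans ?_ (setOf_not_sim_subset 0 1)
  rintro _ rfl h
  rcases h.1 with h | h <;> omega

lemma measure_eps_lt_top (hfin : ∀ n, μ (nontriv n) < ∞) :
    μ {epsLeft 0} < ∞ ∧ μ {epsRight 0} < ∞ :=
  ⟨(measure_mono epsLeft_zero_subset).trans_lt (hfin 2),
    (measure_mono epsRight_zero_subset).trans_lt (hfin 2)⟩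

/-- Transpositions carry `epsLeft 0` to every `epsLeft i`, so these atoms have equal mass, and
likewise on the right. The common mass is finite because the atom at label `0` separates `0` from
`1`. -/
theorem restrict_asymp_eq_one (hμ : Exchangeable μ) (h1 : μ {one} = 0)
    (hfin : ∀ n, μ (nontriv n) < ∞) :
    μ.restrict {γ | γ.HasAsympOpen OpenSub.one} =
      (μ {epsLeft 0}).toNNReal • erosionLeft + (μ {epsRight 0}).toNNReal • erosionRight := by
  have hset : ({γ | γ.HasAsympOpen OpenSub.one} : Set (BlockComposition ℕ)) =ᵐ[μ]
      (range epsLeft ∪ range epsRight : Set (BlockComposition ℕ)) := by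
    filter_upwards [ae_eq_eps hμ h1 hfin] with γ hγ
    refine propext ⟨fun h => hγ (HasAsympOpen.asymp_eq h), ?_⟩
    rintro (⟨i, rfl⟩ | ⟨i, rfl⟩)
    · exact hasAsympOpen_epsLeft i
    · exact hasAsympOpen_epsRight i
  have hdisj : Disjoint (range epsLeft) (range epsRight) := by
    rw [disjoint_left]
    rintro _ ⟨i, rfl⟩ ⟨j, hj⟩
    exact epsLeft_ne_epsRight i j hj.symm
  have hl : ∀ i, μ {epsLeft i} = ((μ {epsLeft 0}).toNNReal : ℝ≥0∞) := fun i => by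
    rw [ENNReal.coe_toNNReal (measure_eps_lt_top hfin).1.ne,
      ← hμ.measure_permute_singleton (finite_support_swap 0 i), permute_epsLeft,
      Equiv.swap_apply_right]
  have hr : ∀ i, μ {epsRight i} = ((μ {epsRight 0}).toNNReal : ℝ≥0∞) := fun i => by
    rw [ENNReal.coe_toNNReal (measure_eps_lt_top hfin).2.ne,
      ← hμ.measure_permute_singleton (finite_support_swap 0 i), permute_epsRight,
      Equiv.swap_apply_right]
  rw [Measure.restrict_congr_set hset, Measure.restrict_union hdisj (countable_range _).measurableSet,
    restrict_range_eq injective_epsLeft hl, restrict_range_eq injective_epsRight hr]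
  rfl

end BlockComposition

/-! ### Jump rates -/

section JumpRates

variable {Ω : Type*} [MeasurableSpace Ω] {P : Measure Ω} {Γ : ℝ≥0 → Ω → BlockComposition ℕ}

lemma two_le_of_ne_one {n : ℕ} {γ : BlockComposition (Fin n)} (hγ : γ ≠ one) : 2 ≤ n := by
  by_contra! h
  refine hγ ?_
  ext i j
  have : i = j := Fin.ext (by omega)
  rw [this]
  exact iff_of_true (γ.le_refl j) trivial

/-- Positivity of the density beyond `T` keeps the inverse survival probabilities finite. -/
lemma firstJumpLaw_Ioi_pos (hΓ : IsRegularCFragmentation P Γ) {n : ℕ} (hn : 2 ≤ n) {T : ℝ}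
    (hT : 0 ≤ T) : firstJumpLaw P Γ n (Ioi T) ≠ 0 := by
  obtain ⟨-, f, hf, hpos, hlaw⟩ := hΓ.density n hn
  have hm : AEMeasurable (fun t => (f t : ℝ≥0∞)) (volume.restrict (Ioi 0)) :=
    (hf.aemeasurable measurableSet_Ioi).coe_nnreal_ennreal
  rw [hlaw, Ne, withDensity_apply_eq_zero' hm]
  intro h0
  have hsub : Ioi T ⊆ {x | (f x : ℝ≥0∞) ≠ 0} ∩ Ioi T := fun x hx =>
    ⟨by simpa using (hpos x (hT.trans_lt hx)).ne', hx⟩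
  have h1 := measure_mono_null hsub h0
  rw [Measure.restrict_apply measurableSet_Ioi, Ioi_inter_Ioi, max_eq_left hT,
    Real.volume_Ioi] at h1
  exact ENNReal.top_ne_zero h1

/-- `Measure.map` of a function that is not a.e. measurable is `0`, which the positive density
excludes. -/
lemma aemeasurable_firstJump (hΓ : IsRegularCFragmentation P Γ) {n : ℕ} (hn : 2 ≤ n) :
    AEMeasurable (fun ω => (firstJump Γ n ω).toReal) P := by
  by_contra h
  refine firstJumpLaw_Ioi_pos hΓ hn le_rfl ?_
  rw [firstJumpLaw, Measure.map_of_not_aemeasurable h]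
  rfl

lemma setOf_le_firstJump_ae_eq (hΓ : IsRegularCFragmentation P Γ) {n : ℕ} (hn : 2 ≤ n) (t : ℝ≥0) :
    (fun ω => (firstJump Γ n ω).toReal) ⁻¹' Ici (t : ℝ) =ᵐ[P]
      {ω | (t : ℝ≥0∞) ≤ firstJump Γ n ω} := by
  filter_upwards [(hΓ.density n hn).1] with ω hω
  refine propext (Iff.symm (?_ : (t : ℝ≥0∞) ≤ firstJump Γ n ω ↔ (t : ℝ) ≤ (firstJump Γ n ω).toReal))
  lift firstJump Γ n ω to ℝ≥0 using hω with a
  simp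

lemma measure_le_firstJump (hΓ : IsRegularCFragmentation P Γ) {n : ℕ} (hn : 2 ≤ n) (t : ℝ≥0) :
    P {ω | (t : ℝ≥0∞) ≤ firstJump Γ n ω} = firstJumpLaw P Γ n (Ici (t : ℝ)) := by
  rw [firstJumpLaw, Measure.map_apply_of_aemeasurable (aemeasurable_firstJump hΓ hn)
    measurableSet_Ici, measure_congr (setOf_le_firstJump_ae_eq hΓ hn t)]

lemma nullMeasurableSet_le_firstJump (hΓ : IsRegularCFragmentation P Γ) {n : ℕ} (hn : 2 ≤ n)
    (t : ℝ≥0) : NullMeasurableSet {ω | (t : ℝ≥0∞) ≤ firstJump Γ n ω} P :=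
  ((aemeasurable_firstJump hΓ hn).nullMeasurableSet_preimage measurableSet_Ici).congr
    (setOf_le_firstJump_ae_eq hΓ hn t)

/-- The difference quotients defining the jump rates, in terms of the law `ρ` of the time of the
first jump on the event that this jump leads to a given state. -/
lemma cond_firstJump_eq (hΓ : IsRegularCFragmentation P Γ) {n : ℕ} {γ : BlockComposition (Fin n)}
    (hγ : γ ≠ one) {ρ : Measure ℝ} (hρ : ∀ B, MeasurableSet B →
      P {ω | firstState Γ n ω = γ ∧ (firstJump Γ n ω).toReal ∈ B} = ρ B) (t s : ℝ≥0) :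
    (ProbabilityTheory.cond P {ω | (t : ℝ≥0∞) ≤ firstJump Γ n ω})
      {ω | firstState Γ n ω = γ ∧ firstJump Γ n ω ∈ Icc (t : ℝ≥0∞) ((t + s : ℝ≥0) : ℝ≥0∞)} =
    (firstJumpLaw P Γ n (Ici (t : ℝ)))⁻¹ * ρ (Icc (t : ℝ) (t + s)) := by
  have hn := two_le_of_ne_one hγ
  rw [ProbabilityTheory.cond, Measure.smul_apply, measure_le_firstJump hΓ hn,
    -- Only the conditioning event has to be null measurable; the event involving `firstState` may
    -- be arbitrary.
    Measure.restrict_apply₀' (nullMeasurableSet_le_firstJump hΓ hn t), smul_eq_mul,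
    inter_eq_left.2 fun ω hω => hω.2.1, ← hρ _ measurableSet_Icc]
  congr 1
  refine measure_congr ?_
  filter_upwards [(hΓ.density n hn).1] with ω hω
  refine propext (and_congr Iff.rfl ?_)
  lift firstJump Γ n ω to ℝ≥0 using hω with a
  simp only [mem_Icc, ENNReal.coe_le_coe, ENNReal.coe_toReal, ← NNReal.coe_add, NNReal.coe_le_coe]

lemma exists_law_of_state (hΓ : IsRegularCFragmentation P Γ) [IsProbabilityMeasure P] {n : ℕ}
    {γ : BlockComposition (Fin n)} (hγ : γ ≠ one) :
    ∃ ρ : Measure ℝ, ρ univ ≤ 1 ∧ ∀ B, MeasurableSet B →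
      P {ω | firstState Γ n ω = γ ∧ (firstJump Γ n ω).toReal ∈ B} = ρ B := by
  obtain ⟨h, -, hh⟩ := hΓ.continuous_state n γ hγ
  have hρ : ∀ B, MeasurableSet B → P {ω | firstState Γ n ω = γ ∧ (firstJump Γ n ω).toReal ∈ B} =
      (firstJumpLaw P Γ n).withDensity (fun t => (h t : ℝ≥0∞)) B := fun B hB => by
    rw [withDensity_apply _ hB, hh B hB]
  refine ⟨_, ?_, hρ⟩
  rw [← hρ _ .univ]
  exact prob_le_one

/-- Fubini: each `x` is covered by the windows starting in `[x - s, x]`. -/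
lemma lintegral_measure_Icc_add (ρ : Measure ℝ) [IsFiniteMeasure ρ] (s : ℝ) :
    ∫⁻ t : ℝ, ρ (Icc t (t + s)) = ENNReal.ofReal s * ρ univ := by
  let S : Set (ℝ × ℝ) := {p | p.1 ≤ p.2 ∧ p.2 ≤ p.1 + s}
  have hS : MeasurableSet S :=
    (measurableSet_le measurable_fst measurable_snd).inter
      (measurableSet_le measurable_snd (measurable_fst.add_const s))
  have h1 : ∀ t : ℝ, Prod.mk t ⁻¹' S = Icc t (t + s) := fun t => rfl
  have h2 : ∀ x : ℝ, (fun t => (t, x)) ⁻¹' S = Icc (x - s) x := fun x => by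
    ext t
    simp only [S, mem_preimage, mem_ofPred_eq, mem_Icc]
    constructor <;> rintro ⟨h, h'⟩ <;> constructor <;> linarith
  calc ∫⁻ t : ℝ, ρ (Icc t (t + s)) = (volume.prod ρ) S := by
        simp only [Measure.prod_apply hS, h1]
    _ = ∫⁻ x, volume (Icc (x - s) x) ∂ρ := by simp only [Measure.prod_apply_symm hS, h2]
    _ = ENNReal.ofReal s * ρ univ := by simp [Real.volume_Icc]

lemma measurable_measure_Icc_add (ρ : Measure ℝ) [IsFiniteMeasure ρ] {s : ℝ} (hs : 0 ≤ s) :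
    Measurable fun t : ℝ => ρ (Icc t (t + s)) := by
  have h : ∀ t : ℝ, ρ (Icc t (t + s)) = ρ (Ici t) - ρ (Ioi (t + s)) := fun t => by
    have hsub : Ioi (t + s) ⊆ Ici t := Ioi_subset_Ici (le_add_of_nonneg_right hs)
    rw [← measure_sdiff hsub measurableSet_Ioi.nullMeasurableSet (measure_ne_top _ _)]
    congr 1
    ext x
    simp
  simp only [h]
  have h1 : Antitone fun t : ℝ => ρ (Ici t) := fun a b hab => measure_mono (Ici_subset_Ici.2 hab)
  have h2 : Antitone fun t : ℝ => ρ (Ioi (t + s)) := fun a b hab =>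
    measure_mono (Ioi_subset_Ioi (by linarith))
  exact h1.measurable.sub h2.measurable

variable {μ : ℝ≥0 → Measure (BlockComposition ℕ)}

/-- Along `s = 1 / (k + 1)` the rate is a sequential limit, as measurability and Fatou require; `ρ`
does not depend on `t`. -/
lemma IsMeasureFamily.tendsto_rate [IsProbabilityMeasure P] (hΓ : IsRegularCFragmentation P Γ)
    (hμ : IsMeasureFamily P Γ μ) {n : ℕ} {γ : BlockComposition (Fin n)} (hγ : γ ≠ one) :
    ∃ ρ : Measure ℝ, ρ univ ≤ 1 ∧ ∀ t : ℝ≥0, Tendsto (fun k : ℕ =>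
      (firstJumpLaw P Γ n (Ici (t : ℝ)))⁻¹ *
        (ρ (Icc (t : ℝ) (t + 1 / ((k : ℝ) + 1))) * ENNReal.ofReal ((k : ℝ) + 1)))
      atTop (𝓝 (μ t (cyl γ))) := by
  obtain ⟨ρ, hρ1, hρ⟩ := exists_law_of_state hΓ hγ
  refine ⟨ρ, hρ1, fun t => ?_⟩
  obtain ⟨q, hq, hqμ⟩ := hμ.rate t n γ hγ
  rw [hqμ]
  have hs : Tendsto (fun k : ℕ => (1 / ((k : ℝ≥0) + 1))) atTop (𝓝[>] 0) := by
    refine tendsto_nhdsWithin_iff.2 ⟨?_, .of_forall fun k => ?_⟩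
    · exact tendsto_one_div_add_atTop_nhds_zero_nat
    · exact mem_Ioi.2 (by positivity)
  refine (hq.comp hs).congr fun k => ?_
  simp only [Function.comp_apply]
  rw [cond_firstJump_eq hΓ hγ hρ, mul_div_assoc]
  congr 1
  have h1 : ((1 / ((k : ℝ≥0) + 1) : ℝ≥0) : ℝ) = 1 / ((k : ℝ) + 1) := by push_cast; rfl
  have h2 : ENNReal.ofReal ((k : ℝ) + 1) = ((k : ℝ≥0) + 1 : ℝ≥0) := by
    rw [ENNReal.ofReal]
    congr 1
    ext
    rw [Real.coe_toNNReal _ (by positivity)]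
    push_cast
    rfl
  rw [h1, h2, div_eq_mul_inv, ← ENNReal.coe_inv (by positivity), one_div ((k : ℝ≥0) + 1), inv_inv]

lemma measurable_firstJumpLaw_Ici {n : ℕ} : Measurable fun t : ℝ => firstJumpLaw P Γ n (Ici t) := by
  have h : Antitone fun t : ℝ => firstJumpLaw P Γ n (Ici t) := fun a b hab =>
    measure_mono (Ici_subset_Ici.2 hab)
  exact h.measurable

lemma IsMeasureFamily.measurable_rate [IsProbabilityMeasure P] (hΓ : IsRegularCFragmentation P Γ)
    (hμ : IsMeasureFamily P Γ μ) {n : ℕ} {γ : BlockComposition (Fin n)} (hγ : γ ≠ one) :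
    Measurable fun t => μ t (cyl γ) := by
  obtain ⟨ρ, hρ1, hρ⟩ := hμ.tendsto_rate hΓ hγ
  have : IsFiniteMeasure ρ := ⟨hρ1.trans_lt ENNReal.one_lt_top⟩
  refine measurable_of_tendsto_metrizable (fun k => ?_) (tendsto_pi_nhds.2 hρ)
  exact (measurable_firstJumpLaw_Ici.comp measurable_coe_nnreal_real).inv.mul
    (((measurable_measure_Icc_add ρ (by positivity)).comp measurable_coe_nnreal_real).mul_const _)

/-- On `[0,T]` the inverse survival probability is at most its value `c` at `T`. Each quotient
integrates to at most `c`, since the window length cancels the factor `k + 1`, and Fatou passes to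
the limit. -/
lemma IsMeasureFamily.lintegral_rate_lt_top [IsProbabilityMeasure P]
    (hΓ : IsRegularCFragmentation P Γ) (hμ : IsMeasureFamily P Γ μ) {n : ℕ}
    {γ : BlockComposition (Fin n)} (hγ : γ ≠ one) {T : ℝ} (hT : 0 ≤ T) :
    ∫⁻ t in Icc 0 T, μ t.toNNReal (cyl γ) < ∞ := by
  obtain ⟨ρ, hρ1, hρ⟩ := hμ.tendsto_rate hΓ hγ
  have : IsFiniteMeasure ρ := ⟨hρ1.trans_lt ENNReal.one_lt_top⟩
  set c := (firstJumpLaw P Γ n (Ici T))⁻¹ with hc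
  have hc_top : c ≠ ∞ := ENNReal.inv_ne_top.2 fun h =>
    firstJumpLaw_Ioi_pos hΓ (two_le_of_ne_one hγ) hT (measure_mono_null Ioi_subset_Ici_self h)
  let g : ℕ → ℝ → ℝ≥0∞ := fun k t =>
    c * (ρ (Icc t (t + 1 / ((k : ℝ) + 1))) * ENNReal.ofReal ((k : ℝ) + 1))
  have hmeas : ∀ k : ℕ, Measurable fun t : ℝ => ρ (Icc t (t + 1 / ((k : ℝ) + 1))) := fun k =>
    measurable_measure_Icc_add ρ (by positivity)
  have hg : ∀ k, Measurable (g k) := fun k => ((hmeas k).mul_const _).const_mul c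
  have hle : ∀ t ∈ Icc 0 T, μ t.toNNReal (cyl γ) ≤ liminf (fun k => g k t) atTop := by
    intro t ht
    rw [← (hρ t.toNNReal).liminf_eq]
    refine liminf_le_liminf (.of_forall fun k => ?_)
    simp only [g, Real.coe_toNNReal t ht.1]
    gcongr
    exact ENNReal.inv_le_inv.2 (measure_mono (Ici_subset_Ici.2 ht.2))
  have hint : ∀ k, ∫⁻ t in Icc 0 T, g k t ≤ c := by
    intro k
    have hk : (0 : ℝ) < (k : ℝ) + 1 := by positivity
    calc ∫⁻ t in Icc 0 T, g k t ≤ ∫⁻ t, g k t := setLIntegral_le_lintegral _ _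
      _ = c * (ENNReal.ofReal (1 / ((k : ℝ) + 1)) * ρ univ * ENNReal.ofReal ((k : ℝ) + 1)) := by
        rw [lintegral_const_mul _ ((hmeas k).mul_const _), lintegral_mul_const _ (hmeas k),
          lintegral_measure_Icc_add]
      _ = c * ρ univ := by
        rw [mul_right_comm, ← ENNReal.ofReal_mul (by positivity), one_div_mul_cancel hk.ne',
          ENNReal.ofReal_one, one_mul]
      _ ≤ c := mul_le_of_le_one_right' hρ1
  calc ∫⁻ t in Icc 0 T, μ t.toNNReal (cyl γ)
      ≤ ∫⁻ t in Icc 0 T, liminf (fun k => g k t) atTop :=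
        setLIntegral_mono (.liminf hg) hle
    _ ≤ liminf (fun k => ∫⁻ t in Icc 0 T, g k t) atTop := lintegral_liminf_le hg
    _ ≤ liminf (fun _ => c) atTop := liminf_le_liminf (.of_forall hint)
    _ = c := by simp
    _ < ∞ := hc_top.lt_top

/-! ### Measurability in time -/

lemma measure_restr_preimage_eq_sum (ρ : Measure (BlockComposition ℕ)) {n : ℕ}
    (B : Finset (BlockComposition (Fin n))) :
    ρ (restr n ⁻¹' B) = ∑ γ ∈ B, ρ (cyl γ) :=
  (sum_measure_preimage_singleton B fun γ _ => measurableSet_restr_preimage {γ}).symm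

lemma IsMeasureFamily.cyl_lt_top (hμ : IsMeasureFamily P Γ μ) (t : ℝ≥0) {n : ℕ}
    {γ : BlockComposition (Fin n)} (hγ : γ ≠ one) : μ t (cyl γ) < ∞ := by
  obtain ⟨q, -, hq⟩ := hμ.rate t n γ hγ
  rw [hq]
  exact ENNReal.coe_lt_top

lemma exists_finset_nontriv (n : ℕ) : ∃ B : Finset (BlockComposition (Fin n)),
    (∀ γ ∈ B, γ ≠ one) ∧ nontriv n = restr n ⁻¹' B := by
  classical
  have : Fintype (BlockComposition (Fin n)) := Fintype.ofFinite _
  refine ⟨Finset.univ.filter (· ≠ one), fun γ hγ => (Finset.mem_filter.1 hγ).2, ?_⟩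
  ext γ
  simp [nontriv]

lemma IsMeasureFamily.nontriv_lt_top (hμ : IsMeasureFamily P Γ μ) (t : ℝ≥0) (n : ℕ) :
    μ t (nontriv n) < ∞ := by
  obtain ⟨B, hB, h⟩ := exists_finset_nontriv n
  rw [h, measure_restr_preimage_eq_sum]
  exact ENNReal.sum_lt_top.2 fun γ hγ => hμ.cyl_lt_top t (hB γ hγ)

lemma IsMeasureFamily.lintegral_nontriv_lt_top [IsProbabilityMeasure P]
    (hΓ : IsRegularCFragmentation P Γ) (hμ : IsMeasureFamily P Γ μ) (n : ℕ) {T : ℝ}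
    (hT : 0 ≤ T) : ∫⁻ t in Icc 0 T, μ t.toNNReal (nontriv n) < ∞ := by
  obtain ⟨B, hB, h⟩ := exists_finset_nontriv n
  simp only [h, measure_restr_preimage_eq_sum]
  have hm : ∀ γ ∈ B, AEMeasurable (fun t : ℝ => μ t.toNNReal (cyl γ))
      (volume.restrict (Icc 0 T)) := fun γ hγ =>
    ((hμ.measurable_rate hΓ (hB γ hγ)).comp measurable_real_toNNReal).aemeasurable
  rw [lintegral_finsetSum' _ hm]
  exact ENNReal.sum_lt_top.2 fun γ hγ => hμ.lintegral_rate_lt_top hΓ (hB γ hγ) hT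

lemma IsMeasureFamily.measurable_inter_nontriv [IsProbabilityMeasure P]
    (hΓ : IsRegularCFragmentation P Γ) (hμ : IsMeasureFamily P Γ μ)
    {S : Set (BlockComposition ℕ)} (hS : S ∈ cylinders) (n : ℕ) :
    Measurable fun t => μ t (S ∩ nontriv n) := by
  obtain ⟨m, B, hB⟩ := inter_nontriv_mem_cylinders hS n
  -- Rates are prescribed only for nontrivial compositions; intersecting with `nontriv n` removes
  -- the trivial one.
  have hone : one ∉ B := by
    intro h
    have h1 : (one : BlockComposition ℕ) ∈ S ∩ nontriv n := by rw [hB]; exact h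
    exact h1.2 rfl
  lift B to Finset (BlockComposition (Fin m)) using B.toFinite
  simp only [hB, measure_restr_preimage_eq_sum]
  exact Finset.measurable_sum _ fun γ hγ => hμ.measurable_rate hΓ fun h => hone (h ▸ hγ)

lemma IsMeasureFamily.measurable_restrict [IsProbabilityMeasure P]
    (hΓ : IsRegularCFragmentation P Γ) (hμ : IsMeasureFamily P Γ μ) (n : ℕ) :
    Measurable fun t => (μ t).restrict (nontriv n) := by
  have : ∀ t, IsFiniteMeasure ((μ t).restrict (nontriv n)) := fun t =>
    ⟨by simpa using hμ.nontriv_lt_top t n⟩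
  have hcyl : ∀ S ∈ cylinders, Measurable fun t => (μ t).restrict (nontriv n) S := by
    rintro _ ⟨k, B, rfl⟩
    simp only [Measure.restrict_apply (measurableSet_restr_preimage B)]
    exact hμ.measurable_inter_nontriv hΓ ⟨k, B, rfl⟩ n
  exact Measurable.measure_of_isPiSystem generateFrom_cylinders isPiSystem_cylinders hcyl
    (hcyl univ ⟨0, univ, rfl⟩)

/-- `μ t` may be infinite, so measurability in `t` is obtained on each `nontriv n`, where the
π-system argument applies, and passed to the supremum. -/
lemma IsMeasureFamily.measurable_lintegral [IsProbabilityMeasure P]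
    (hΓ : IsRegularCFragmentation P Γ) (hμ : IsMeasureFamily P Γ μ)
    {g : BlockComposition ℕ → ℝ≥0∞} (hg : Measurable g) :
    Measurable fun t => ∫⁻ γ, g γ ∂(μ t) := by
  have h : ∀ t, ∫⁻ γ, g γ ∂(μ t) = ⨆ n, ∫⁻ γ, g γ ∂(μ t).restrict (nontriv n) := fun t => by
    have h0 : (μ t).withDensity g {one} = 0 :=
      withDensity_absolutelyContinuous _ _ (hμ.one_eq_zero t)
    have h1 := measure_eq_iSup_nontriv h0 univ
    simpa only [univ_inter, withDensity_apply _ (measurableSet_nontriv _),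
      withDensity_apply _ MeasurableSet.univ, Measure.restrict_univ] using h1
  simp only [h]
  exact .iSup fun n => (Measure.measurable_lintegral hg).comp (hμ.measurable_restrict hΓ n)

lemma IsMeasureFamily.measurable_apply [IsProbabilityMeasure P]
    (hΓ : IsRegularCFragmentation P Γ) (hμ : IsMeasureFamily P Γ μ)
    {S : Set (BlockComposition ℕ)} (hS : MeasurableSet S) : Measurable fun t => μ t S := by
  have := hμ.measurable_lintegral hΓ (g := S.indicator 1) (measurable_one.indicator hS)
  simpa only [lintegral_indicator_one hS] using this

lemma IsMeasureFamily.measurable_lintegral_dislocation [IsProbabilityMeasure P]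
    (hΓ : IsRegularCFragmentation P Γ) (hμ : IsMeasureFamily P Γ μ) :
    Measurable fun t => ∫⁻ U, (1 - U.s1) ∂(dislocation (μ t)) := by
  have hs : Measurable fun U : OpenSub => 1 - U.s1 := OpenSub.measurable_s1.const_sub 1
  have hA : MeasurableSet (asymp ⁻¹' {OpenSub.one}ᶜ) :=
    measurable_asymp (measurableSet_singleton _).compl
  simp only [dislocation, lintegral_map hs measurable_asymp, ← lintegral_indicator hA]
  exact hμ.measurable_lintegral hΓ ((hs.comp measurable_asymp).indicator hA)

end JumpRates

/-! ### The decomposition and its integrability in time -/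

theorem corollary4p5 {Ω : Type*} [MeasurableSpace Ω] (P : Measure Ω) [IsProbabilityMeasure P]
    (Γ : ℝ≥0 → Ω → BlockComposition ℕ) (hΓ : IsRegularCFragmentation P Γ)
    (μ : ℝ≥0 → Measure (BlockComposition ℕ)) (hμ : IsMeasureFamily P Γ μ) :
    ∃ (ν : ℝ≥0 → Measure OpenSub) (cl cr : ℝ≥0 → ℝ≥0),
      (∀ t, IsDislocationMeasure (ν t) ∧
        (∀ᵐ γ ∂(μ t), ∃ U, γ.HasAsympOpen U) ∧
        (μ t).restrict {γ | ∃ U, U ≠ OpenSub.one ∧ γ.HasAsympOpen U} = paintMeasure (ν t) ∧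
        (μ t).restrict {γ | γ.HasAsympOpen OpenSub.one} =
          cl t • erosionLeft + cr t • erosionRight) ∧
      Measurable (fun t => ∫⁻ U, (1 - U.s1) ∂(ν t)) ∧ Measurable cl ∧ Measurable cr ∧
      ∀ T : ℝ, 0 ≤ T →
        (∫⁻ t in Icc 0 T, ∫⁻ U, (1 - U.s1) ∂(ν t.toNNReal)) < ∞ ∧
        (∫⁻ t in Icc 0 T, ((cl t.toNNReal + cr t.toNNReal : ℝ≥0) : ℝ≥0∞)) < ∞ := by
  have hex : ∀ t, Exchangeable (μ t) := hμ.exchangeable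
  have h1 : ∀ t, μ t {one} = 0 := hμ.one_eq_zero
  have hfin : ∀ t n, μ t (nontriv n) < ∞ := hμ.nontriv_lt_top
  refine ⟨fun t => dislocation (μ t), fun t => (μ t {epsLeft 0}).toNNReal,
    fun t => (μ t {epsRight 0}).toNNReal, fun t => ⟨?_, ?_, ?_, ?_⟩, ?_, ?_, ?_, fun T hT => ⟨?_, ?_⟩⟩
  · exact isDislocationMeasure_dislocation (hex t) (h1 t) (hfin t)
  · exact ae_exists_hasAsympOpen (hex t) (h1 t) (hfin t)
  · rw [setOf_asymp_ne_one]
    exact restrict_asymp_ne_one (hex t) (h1 t) (hfin t)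
  · exact restrict_asymp_eq_one (hex t) (h1 t) (hfin t)
  · exact hμ.measurable_lintegral_dislocation hΓ
  · exact (hμ.measurable_apply hΓ (measurableSet_singleton _)).ennreal_toNNReal
  · exact (hμ.measurable_apply hΓ (measurableSet_singleton _)).ennreal_toNNReal
  · exact (lintegral_mono fun t : ℝ => lintegral_one_sub_s1_dislocation_le (hex t.toNNReal)
      (h1 t.toNNReal) (hfin t.toNNReal)).trans_lt (hμ.lintegral_nontriv_lt_top hΓ 2 hT)
  -- Both atoms lie in `nontriv 2`; bounding them separately costs the factor `2`.
  · have hle : ∀ t : ℝ≥0, (((μ t {epsLeft 0}).toNNReal + (μ t {epsRight 0}).toNNReal : ℝ≥0) : ℝ≥0∞) ≤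
        2 * μ t (nontriv 2) := fun t => by
      rw [ENNReal.coe_add, two_mul, ENNReal.coe_toNNReal (measure_eps_lt_top (hfin t)).1.ne,
        ENNReal.coe_toNNReal (measure_eps_lt_top (hfin t)).2.ne]
      exact add_le_add (measure_mono epsLeft_zero_subset) (measure_mono epsRight_zero_subset)
    refine (lintegral_mono fun t : ℝ => hle t.toNNReal).trans_lt ?_
    rw [lintegral_const_mul' _ _ (by simp)]
    exact ENNReal.mul_lt_top (by simp) (hμ.lintegral_nontriv_lt_top hΓ 2 hT)
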